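/- **Setting.** There are $d\ge 1$ experts and $T\ge 1$ rounds. An oblivious adversary fixes a sequence $\ell_1,\dots,\ell_T\in[0,1]^d$ in advance. A randomized algorithm $\mathcal A$ that plays $\mathcal A(\ell_{1:T})=(x_1,\dots,x_T)\in[d]^T$ is $(\varepsilon,\delta)$-differentially private (DP) if $\Pr[\mathcal A(\ell)\in O]\le e^{\varepsilon}\Pr[\mathcal A(\ell')\in O]+\delta$ for all sequences $\ell,\ell'$ in $[0,1]^d$ that differ in a single round and all events $O$; $\varepsilon$-DP means $(\varepsilon,0)$-DP. $\log$ is the natural logarithm. **Algorithm** (parameters $K,L^\star,\eta,L,\varepsilon$). Start with a uniformly random expert $x_0$, $k=0$, $t_p=0$. In round $t$ play $x_t=x_{t-1}$, except when a new expert is sampled as described below. As long as $k<K$, run instances of AboveThreshold with privacy parameter $\varepsilon/2$, one after the other: a new instance draws a noisy threshold $\hat L=L+\mathrm{Lap}(4/\varepsilon)$; in each round $t$ in which it runs, before $\ell_t$ is received, it is asked the query $q_t=\sum_{i=t_p}^{t-1}\ell_i(x_t)$ (with $\ell_0=0$), and it halts after that round if $q_t+\mathrm{Lap}(8/\varepsilon)\ge\hat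 L$ (all noise independent). If it halted after round $t-1$, then in round $t$ the expert $x_t$ is sampled from the exponential mechanism $\Pr[x_t=x]\propto e^{-\eta s_t(x)/2}$, $s_t(x)=\max\{\sum_{i=1}^{t-1}\ell_i(x),L^\star\}$, one sets $k\leftarrow k+1$ and $t_p\leftarrow t$, no query is asked in that round, and (if $k<K$) a new instance starts in round $t+1$. **Theorem.** For every $c>0$ there is a constant $C>0$, depending only on $c$, such that the following holds for all $d,T\ge1$, $L^\star\ge 0$, $\varepsilon>0$ and $0<\beta<1/2$. Let $B=\log(2T^2/\beta)$, $K=6\lceil\log d\rceil+24\log(1/\beta)$ and $L=L^\star+4/\eta+8B/\varepsilon$. The loss bounds are claimed for every sequence $\ell_1,\dots,\ell_T\in[0,1]^d$ for which some $x^\star\in[d]$ has $\sum_{t=1}^T\ell_t(x^\star)\le L^\star$. 1. Let $\eta=\varepsilon/(2K)$. Then the algorithm is $\varepsilon$-DP. If moreover $\varepsilon\le c\log(T/\beta)$, then with probability at least $1-C\beta$ $$\sum_{t=1}^T\ell_t(x_t)\le C\Big(L^\star\log(d/\beta)+\frac{\log^2 d+\log(T/\beta)\log(d/\beta)}{\varepsilon}\Big).$$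 2. Let $0<\delta<1$, $\varepsilon\le\sqrt{\log T\,\log(1/\delta)}$ and $\eta=\varepsilon/\big(4\sqrt{2K\log(1/\delta)}\big)$. (a) If $\varepsilon\le\log(1/\delta)$ (for instance if $\delta\le 1/T$), then the algorithm is $(\varepsilon,\delta)$-DP. (b) If $\varepsilon\le c\log(T/\beta)$, then with probability at least $1-C\beta$ $$\sum_{t=1}^T\ell_t(x_t)\le C\Big(L^\star\log(d/\beta)+\frac{\log^{3/2}(d/\beta)\sqrt{\log(1/\delta)}+\log(T/\beta)\log(d/\beta)}{\varepsilon}\Big),$$ and if in addition $\delta\ge(\beta/T)^c$ or $\beta\ge d^{-c}$, then with probability at least $1-C\beta$ $$\sum_{t=1}^T\ell_t(x_t)\le C\Big(L^\star\log(d/\beta)+\frac{\log^{3/2}(d)\sqrt{\log(1/\delta)}+\log(T/\beta)\log(d/\beta)}{\varepsilon}\Big).$$ -/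

import Mathlib

open MeasureTheory

noncomputable section

namespace PrivateExperts

/-- A loss sequence `ℓ_1, …, ℓ_T ∈ [0,1]^d`, fixed in advance by an oblivious adversary.
Rounds are numbered `0, …, T - 1`. -/
abbrev Losses (T d : ℕ) : Type := Fin T → Fin d → unitInterval

/-- `(ε, δ)`-differential privacy of a randomized algorithm `A`, given by its output laws:
the inequality holds for all inputs that differ in a single element and all events. -/
def IsDP {T : ℕ} {Z O : Type*} [MeasurableSpace O] (A : (Fin T → Z) → Measure O)
    (ε δ : ℝ) : Prop :=
  ∀ D D' : Fin T → Z, (∃ i, ∀ j, j ≠ i → D j = D' j) →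
    ∀ S : Set O, MeasurableSet S →
      A D S ≤ ENNReal.ofReal (Real.exp ε) * A D' S + ENNReal.ofReal δ

/-- The centred Laplace distribution with scale `b`. -/
def laplace (b : ℝ) : Measure ℝ :=
  volume.withDensity fun x => ENNReal.ofReal (Real.exp (-|x| / b) / (2 * b))

/-- `∑_{i = s}^{t - 1} ℓ_i(x)`. -/
def lossBetween {T d : ℕ} (ℓ : Losses T d) (s t : ℕ) (x : Fin d) : ℝ :=
  ∑ i : Fin T with s ≤ i.val ∧ i.val < t, (ℓ i x : ℝ)

/-- The score `s_t(x) = max (∑_{i < t} ℓ_i(x), L⋆)` of the exponential mechanism. -/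
def score {T d : ℕ} (Lstar : ℝ) (ℓ : Losses T d) (t : ℕ) (x : Fin d) : ℝ :=
  max (lossBetween ℓ 0 t x) Lstar

/-- The exponential mechanism: `P(x) ∝ exp (-η s(x) / 2)`. -/
def expMech {d : ℕ} [NeZero d] (η : ℝ) (s : Fin d → ℝ) : PMF (Fin d) :=
  PMF.normalize (fun x => ENNReal.ofReal (Real.exp (-η * s x / 2)))
    (by simp [Real.exp_pos]) (by simp [tsum_fintype])

/-- What the algorithm is doing between two rounds:
* `idle`: no instance of AboveThreshold is running;
* `monitoring r`: an instance of AboveThreshold, initialized in round `r`, is running, and all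
  its queries have been answered negatively so far;
* `triggered`: the last query was reported to be above the threshold. -/
inductive Phase (T : ℕ) : Type
  | idle
  | monitoring (r : Fin T)
  | triggered

/-- The state of the algorithm between two rounds: the current expert, the number `k` of switches
so far, the first round `t_p` that is counted in the current queries, and the phase. -/
structure State (T d : ℕ) : Type where
  expert : Fin d
  switches : ℕ
  start : ℕ
  phase : Phase T

/-- The fresh randomness available in one round: the noise added to the threshold if an instance of
AboveThreshold is initialized in this round, the noise added to the query if a query is asked in
this round, and the outcome of the exponential mechanism if it is applied in this round. -/
abbrev Seed (d : ℕ) : Type := ℝ × ℝ × Fin d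

/-- AboveThreshold with threshold `L`, initialized in round `r`, is asked in round `t` for the loss
that the current expert has accumulated since round `s.start`; it answers positively iff the noisy
query is at least the noisy threshold. -/
def askQuery {T d : ℕ} (L : ℝ) (ℓ : Losses T d) (ω : Fin T → Seed d) (t r : Fin T)
    (s : State T d) : State T d :=
  { s with
    phase :=
      if L + (ω r).1 ≤ lossBetween ℓ s.start t s.expert + (ω t).2.1 then .triggered
      else .monitoring r }

/-- One round of the algorithm. The expert played in the round is the expert of the new state. -/
def step {T d : ℕ} (K L : ℝ) (ℓ : Losses T d) (ω : Fin T → Seed d) (t : Fin T)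
    (s : State T d) : State T d :=
  match s.phase with
  | .triggered =>
      { expert := (ω t).2.2, switches := s.switches + 1, start := t, phase := .idle }
  | .monitoring r => askQuery L ℓ ω t r s
  | .idle => if (s.switches : ℝ) < K then askQuery L ℓ ω t t s else s

/-- The state after the first `n` rounds, for the initial expert `x₀` and the seeds `ω`. -/
def stateAfter {T d : ℕ} (K L : ℝ) (ℓ : Losses T d) (x₀ : Fin d) (ω : Fin T → Seed d) :
    ℕ → State T d
  | 0 => { expert := x₀, switches := 0, start := 0, phase := .idle }
  | n + 1 =>
      if h : n < T then step K L ℓ ω ⟨n, h⟩ (stateAfter K L ℓ x₀ ω n)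
      else stateAfter K L ℓ x₀ ω n

/-- The experts `(x_1, …, x_T)` played by the algorithm. -/
def plays {T d : ℕ} (K L : ℝ) (ℓ : Losses T d) (p : Fin d × (Fin T → Seed d)) : Fin T → Fin d :=
  fun t => (stateAfter K L ℓ p.1 p.2 (t + 1)).expert

/-- The law of the randomness: the initial expert is uniform, and independently of it and of each
other the rounds have independent seeds. An instance of AboveThreshold with privacy parameter
`ε / 2` perturbs its threshold by Laplace noise of scale `2 / (ε / 2)` and its queries by Laplace
noise of scale `4 / (ε / 2)`. Since the scores are a function of the loss sequence, the
outcome of the exponential mechanism for each round may be drawn independently in advance. -/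
def randomness {T d : ℕ} [NeZero d] (Lstar η ε : ℝ) (ℓ : Losses T d) :
    Measure (Fin d × (Fin T → Seed d)) :=
  (PMF.uniformOfFintype (Fin d)).toMeasure.prod
    (Measure.pi fun t : Fin T =>
      (laplace (2 / (ε / 2))).prod
        ((laplace (4 / (ε / 2))).prod (expMech η (score Lstar ℓ t)).toMeasure))

/-- The sparse-vector algorithm for low-loss experts with switching bound `K`, optimal loss `Lstar`,
sampling parameter `η`, threshold `L` and privacy parameter `ε`: the law of the sequence of experts
it plays on a loss sequence. -/
def sparseVectorExperts {T d : ℕ} [NeZero d] (K Lstar η L ε : ℝ) (ℓ : Losses T d) :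
    Measure (Fin T → Fin d) :=
  (randomness Lstar η ε ℓ).map (plays K L ℓ)

/-- The switching bound `K = 6 ⌈log d⌉ + 24 log (1/β)`. -/
def switchBound (d : ℕ) (β : ℝ) : ℝ :=
  6 * (⌈Real.log d⌉₊ : ℝ) + 24 * Real.log (1 / β)

/-- The threshold `L = L⋆ + 4/η + 8B/ε` with `B = log (2T²/β)`. -/
def threshold (T : ℕ) (Lstar η ε β : ℝ) : ℝ :=
  Lstar + 4 / η + 8 * Real.log (2 * (T : ℝ) ^ 2 / β) / ε

/-- The total loss `∑_t ℓ_t(x_t)` of a sequence of experts. -/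
def totalLoss {T d : ℕ} (ℓ : Losses T d) (x : Fin T → Fin d) : ℝ :=
  ∑ t, (ℓ t (x t) : ℝ)

end PrivateExperts

end

/-!
The randomness of the algorithm consists of the initial expert, the Laplace noise and the outcomes
of the exponential mechanism in all rounds. The *transcript* is the sequence of states that the
algorithm passes through. It takes countably many values, and its law factorizes
(`transcriptLaw_singleton`): the probability of a transcript `σ` is that of its initial expert,
times the probability that the noise is consistent with the answers recorded in `σ`, times the
probabilities of the experts sampled in `σ`. The last factor involves only those rounds in which an
expert is sampled. Hence changing the laws of the sampled experts multiplies the probability of a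
transcript by the product of the likelihood ratios over these rounds. In particular, if the `g t`
have expectation at most one under the laws of the sampled experts, then their product over the
rounds in which an expert is sampled has expectation at most one as well
(`lintegral_prod_switchRounds_le_one`). This takes the place of a supermartingale argument in both
the privacy and the utility proof.

*Privacy.* The loss of a single round is counted by the queries of only one instance of
AboveThreshold, and all of these queries concern the same expert, so that they move in the same
direction. A shift of one coordinate of the noise therefore shows that the probability of the
answers changes by a factor of at most `exp (ε / 4)` (`noiseLaw_consistentNoise_le`). An expert is
sampled at most `K + 1` times, and each time the likelihood ratio is at most `exp η`. For pure
privacy these bounds are multiplied (`isDP_pure`). For approximate privacy, Hoeffding's lemma bounds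
the moments of the likelihood ratio of one sample (`sum_mul_ratio_rpow_le`), and Markov's inequality
for a power of the product shows that it exceeds `exp (3 ε / 4)` with probability at most `δ`
(`isDP_approx`).

*Utility.* With probability at least `1 - 2 β`, the noise of any query and that of any threshold
differ by less than `8 B / ε` (`seedLaw_noise_le`). Then each expert suffers a loss of at most
`L + 8 B / ε + 2` before it is replaced, as long as fewer than `K` switches have occurred
(`totalLoss_plays_le`), and an expert is replaced only after its loss has exceeded `L⋆ + 4 / η`. Of
the experts, weighted as in the exponential mechanism, at least one half is expected to exceed this
loss no later than the sampled one. Their weights drop by a factor of `exp (-2)`, so a replacement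
multiplies the total weight in expectation by at most `(1 + exp (-2)) / 2 ≤ exp (-1 / 2)`
(`sum_weight_mul_decay_le`). As the best expert keeps its weight, the total weight never drops below
the initial one divided by `d` (`exp_neg_two_div_le_prod_decay`), and Markov's inequality shows that
`K` switches occur with probability at most `β` (`seedLaw_switches_le`).
-/

noncomputable section

namespace PrivateExperts

variable {T d : ℕ}

/-! ### The Laplace distribution -/

/-- The density of the Laplace distribution of scale `b`. -/
def laplaceDensity (b x : ℝ) : ENNReal := ENNReal.ofReal (Real.exp (-|x| / b) / (2 * b))

lemma measurable_laplaceDensity (b : ℝ) : Measurable (laplaceDensity b) := by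
  unfold laplaceDensity
  fun_prop

lemma laplace_apply (b : ℝ) {S : Set ℝ} (hS : MeasurableSet S) :
    laplace b S = ∫⁻ x in S, laplaceDensity b x :=
  withDensity_apply _ hS

lemma integral_exp_neg_abs_div {b : ℝ} (hb : 0 < b) : ∫ x : ℝ, Real.exp (-|x| / b) = 2 * b := by
  have h := integral_comp_abs (f := fun x => Real.exp (-x / b))
  have h2 := integral_exp_mul_Ioi (a := -b⁻¹) (by simpa using hb) 0
  have h3 : (fun x : ℝ => Real.exp (-x / b)) = fun x => Real.exp (-b⁻¹ * x) := by
    ext x; congr 1; field_simp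
  rw [h, h3, h2]
  simp

lemma isProbabilityMeasure_laplace {b : ℝ} (hb : 0 < b) : IsProbabilityMeasure (laplace b) := by
  refine ⟨?_⟩
  have hint : Integrable fun x : ℝ => Real.exp (-|x| / b) / (2 * b) := by
    refine Integrable.div_const (not_imp_comm.1 integral_undef ?_) _
    rw [integral_exp_neg_abs_div hb]
    positivity
  rw [laplace_apply b MeasurableSet.univ, Measure.restrict_univ]
  unfold laplaceDensity
  rw [← ofReal_integral_eq_lintegral_ofReal hint (ae_of_all _ fun x => by positivity),
    integral_div, integral_exp_neg_abs_div hb, div_self (by positivity), ENNReal.ofReal_one]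

lemma laplaceDensity_sub_le {b : ℝ} (hb : 0 < b) (a x : ℝ) :
    laplaceDensity b (x - a) ≤ ENNReal.ofReal (Real.exp (|a| / b)) * laplaceDensity b x := by
  unfold laplaceDensity
  rw [← ENNReal.ofReal_mul (by positivity), ← mul_div_assoc, ← Real.exp_add, ← add_div]
  gcongr
  linarith [abs_sub_abs_le_abs_sub x a, abs_sub_comm x a]

/-- Translating Laplace noise changes the probability of an event by a factor of at most
`exp (|a| / b)`. -/
lemma laplace_map_add_le {b : ℝ} (hb : 0 < b) (a : ℝ) :
    (laplace b).map (· + a) ≤ ENNReal.ofReal (Real.exp (|a| / b)) • laplace b := by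
  refine Measure.le_iff.2 fun S hS => ?_
  have hm : Measurable fun x : ℝ => x + a := by fun_prop
  rw [Measure.map_apply hm hS, laplace_apply b (hm hS), Measure.smul_apply, smul_eq_mul,
    laplace_apply b hS, ← lintegral_indicator (hm hS), ← lintegral_const_mul _
      (measurable_laplaceDensity b), ← lintegral_indicator hS]
  rw [← lintegral_sub_right_eq_self _ a]
  refine lintegral_mono fun x => ?_
  by_cases hx : x ∈ S
  · simpa [Set.indicator, hx] using laplaceDensity_sub_le hb a x
  · simp [Set.indicator, hx]

lemma laplace_Ici_le {b : ℝ} (hb : 0 < b) (u : ℝ) :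
    laplace b (Set.Ici u) ≤ ENNReal.ofReal (Real.exp (-u / b)) := by
  have := isProbabilityMeasure_laplace hb
  rcases le_total u 0 with hu | hu
  · refine prob_le_one.trans ?_
    rw [ENNReal.one_le_ofReal, Real.one_le_exp_iff]
    exact div_nonneg (by linarith) hb.le
  · -- on `[u, ∞)` the density at `x` is `exp (-u / b)` times the density at `x - u`
    have key : ∀ x ∈ Set.Ici u, laplaceDensity b x ≤
        ENNReal.ofReal (Real.exp (-u / b)) * laplaceDensity b (x - u) := by
      intro x hx
      rw [Set.mem_Ici] at hx
      unfold laplaceDensity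
      rw [← ENNReal.ofReal_mul (by positivity), ← mul_div_assoc, ← Real.exp_add, ← add_div,
        abs_of_nonneg (by linarith), abs_of_nonneg (by linarith)]
      gcongr
      linarith
    calc laplace b (Set.Ici u) = ∫⁻ x in Set.Ici u, laplaceDensity b x :=
          laplace_apply b measurableSet_Ici
      _ ≤ ∫⁻ x in Set.Ici u, ENNReal.ofReal (Real.exp (-u / b)) * laplaceDensity b (x - u) :=
          setLIntegral_mono' measurableSet_Ici key
      _ ≤ ∫⁻ x, ENNReal.ofReal (Real.exp (-u / b)) * laplaceDensity b (x - u) :=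
          setLIntegral_le_lintegral _ _
      _ = ENNReal.ofReal (Real.exp (-u / b)) * ∫⁻ x, laplaceDensity b x := by
          rw [lintegral_const_mul _ (by unfold laplaceDensity; fun_prop),
            lintegral_sub_right_eq_self (laplaceDensity b) u]
      _ = ENNReal.ofReal (Real.exp (-u / b)) := by
          rw [← setLIntegral_univ, ← laplace_apply b MeasurableSet.univ, measure_univ, mul_one]

lemma laplace_neg_preimage (b : ℝ) {S : Set ℝ} (hS : MeasurableSet S) :
    laplace b (Neg.neg ⁻¹' S) = laplace b S := by
  have hm : Measurable fun x : ℝ => -x := by fun_prop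
  rw [laplace_apply b hS, laplace_apply b (hm hS), ← lintegral_indicator (hm hS),
    ← lintegral_indicator hS, ← lintegral_neg_eq_self]
  refine lintegral_congr fun x => ?_
  by_cases hx : x ∈ S
  · simp [Set.indicator, laplaceDensity, hx]
  · simp [Set.indicator, hx]

lemma laplace_Iic_le {b : ℝ} (hb : 0 < b) (u : ℝ) :
    laplace b (Set.Iic u) ≤ ENNReal.ofReal (Real.exp (u / b)) := by
  have h := laplace_neg_preimage b (measurableSet_Ici (a := -u))
  have h2 : (Neg.neg ⁻¹' Set.Ici (-u) : Set ℝ) = Set.Iic u := by ext; simp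
  rw [← h2, h]
  simpa using laplace_Ici_le hb (-u)

lemma lintegral_exp_abs_laplace_half_le {b : ℝ} (hb : 0 < b) :
    ∫⁻ x, ENNReal.ofReal (Real.exp (|x| / b)) ∂laplace (b / 2) ≤ 2 := by
  have := isProbabilityMeasure_laplace hb
  rw [show laplace (b / 2) = volume.withDensity (laplaceDensity (b / 2)) from rfl,
    lintegral_withDensity_eq_lintegral_mul _ (measurable_laplaceDensity _) (by fun_prop)]
  have key : ∀ x, (laplaceDensity (b / 2) * fun x => ENNReal.ofReal (Real.exp (|x| / b))) x
      = 2 * laplaceDensity b x := by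
    intro x
    unfold laplaceDensity
    rw [Pi.mul_apply, ← ENNReal.ofReal_mul (by positivity), ← ENNReal.ofReal_ofNat 2,
      ← ENNReal.ofReal_mul (by positivity), div_mul_eq_mul_div, ← Real.exp_add]
    congr 1
    rw [show -|x| / (b / 2) + |x| / b = -|x| / b by field_simp; ring]
    field_simp
  refine (lintegral_congr key).trans_le ?_
  rw [lintegral_const_mul _ (measurable_laplaceDensity b), ← setLIntegral_univ,
    ← laplace_apply b MeasurableSet.univ, measure_univ, mul_one]

/-- The difference of the noise of a query and the noise of a threshold, whose scale is half as
large, has the tail of the former alone up to a constant factor. -/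
lemma laplace_prod_le_sub_le {b : ℝ} (hb : 0 < b) (u : ℝ) :
    ((laplace (b / 2)).prod (laplace b)) {z | u ≤ z.2 - z.1} ≤
      ENNReal.ofReal (2 * Real.exp (-u / b)) := by
  have := isProbabilityMeasure_laplace hb
  have := isProbabilityMeasure_laplace (half_pos hb)
  rw [Measure.prod_apply (measurableSet_le (by fun_prop) (by fun_prop))]
  calc _ ≤ ∫⁻ x, ENNReal.ofReal (Real.exp (-u / b)) * ENNReal.ofReal (Real.exp (|x| / b))
        ∂laplace (b / 2) := by
        refine lintegral_mono fun x => ?_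
        have : Prod.mk x ⁻¹' {z : ℝ × ℝ | u ≤ z.2 - z.1} = Set.Ici (u + x) := by
          ext y; simp [le_sub_iff_add_le]
        rw [this, ← ENNReal.ofReal_mul (by positivity), ← Real.exp_add, ← add_div]
        refine (laplace_Ici_le hb _).trans ?_
        gcongr
        linarith [neg_abs_le x]
    _ ≤ ENNReal.ofReal (Real.exp (-u / b)) * 2 := by
        rw [lintegral_const_mul _ (by fun_prop)]
        gcongr
        exact lintegral_exp_abs_laplace_half_le hb
    _ = _ := by
        rw [mul_comm, ← ENNReal.ofReal_ofNat 2, ← ENNReal.ofReal_mul (by positivity)]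

lemma laplace_prod_le_sub_le' {b : ℝ} (hb : 0 < b) (u : ℝ) :
    ((laplace (b / 2)).prod (laplace b)) {z | u ≤ z.1 - z.2} ≤
      ENNReal.ofReal (2 * Real.exp (-u / b)) := by
  have := isProbabilityMeasure_laplace hb
  have := isProbabilityMeasure_laplace (half_pos hb)
  rw [Measure.prod_apply (measurableSet_le (by fun_prop) (by fun_prop))]
  calc _ ≤ ∫⁻ x, ENNReal.ofReal (Real.exp (-u / b)) * ENNReal.ofReal (Real.exp (|x| / b))
        ∂laplace (b / 2) := by
        refine lintegral_mono fun x => ?_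
        have : Prod.mk x ⁻¹' {z : ℝ × ℝ | u ≤ z.1 - z.2} = Set.Iic (x - u) := by
          ext y; simp; constructor <;> intro h <;> linarith
        rw [this, ← ENNReal.ofReal_mul (by positivity), ← Real.exp_add, ← add_div]
        refine (laplace_Iic_le hb _).trans ?_
        gcongr
        linarith [le_abs_self x]
    _ ≤ ENNReal.ofReal (Real.exp (-u / b)) * 2 := by
        rw [lintegral_const_mul _ (by fun_prop)]
        gcongr
        exact lintegral_exp_abs_laplace_half_le hb
    _ = _ := by
        rw [mul_comm, ← ENNReal.ofReal_ofNat 2, ← ENNReal.ofReal_mul (by positivity)]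

lemma measurable_update_add {ι : Type*} [DecidableEq ι] (j : ι) (a : ℝ) :
    Measurable fun z : ι → ℝ => Function.update z j (z j + a) := by
  refine measurable_pi_iff.2 fun i => ?_
  by_cases h : i = j
  · subst h; simp only [Function.update_self]; fun_prop
  · simp only [Function.update_of_ne h]; fun_prop

/-- Translating one coordinate of independent Laplace noise changes the probability of an event
by a factor of at most `exp (|a| / b)`. -/
lemma pi_laplace_map_update_le {ι : Type*} [Fintype ι] [DecidableEq ι] {b : ℝ} (hb : 0 < b) (j : ι)
    (a : ℝ) :
    (Measure.pi fun _ : ι => laplace b).map (fun z => Function.update z j (z j + a)) ≤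
      ENNReal.ofReal (Real.exp (|a| / b)) • Measure.pi fun _ : ι => laplace b := by
  have := isProbabilityMeasure_laplace hb
  have hm := measurable_update_add j a
  refine Measure.le_iff.2 fun S hS => ?_
  rw [Measure.map_apply hm hS, Measure.smul_apply, smul_eq_mul, ← lintegral_indicator_one hS,
    ← lintegral_indicator_one (hm hS), ← lintegral_const_mul _ (measurable_one.indicator hS)]
  refine lintegral_le_of_lmarginal_le {j} (measurable_one.indicator (hm hS))
    ((measurable_one.indicator hS).const_mul _) ?_
  rw [lmarginal_singleton, lmarginal_singleton]
  intro z
  have hu : Measurable fun x : ℝ => Function.update z j x := measurable_update z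
  have hS' : MeasurableSet {x : ℝ | Function.update z j x ∈ S} := hu hS
  have h := laplace_map_add_le hb a {x : ℝ | Function.update z j x ∈ S}
  have hadd : Measurable fun x : ℝ => x + a := by fun_prop
  rw [Measure.map_apply hadd hS', Measure.smul_apply, smul_eq_mul,
    ← lintegral_indicator_one hS', ← lintegral_indicator_one (hadd hS'),
    ← lintegral_const_mul _ (measurable_one.indicator hS')] at h
  have hz : ∀ x : ℝ, Function.update z j x ∈ (fun z => Function.update z j (z j + a)) ⁻¹' S ↔
      Function.update z j (x + a) ∈ S := by simp
  convert h using 3 with x x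
  · by_cases hx : Function.update z j (x + a) ∈ S
    · simp [Set.indicator, (hz x).2 hx, hx]
    · simp [Set.indicator, mt (hz x).1 hx, hx]
  · rfl

/-! ### Transcripts -/

instance : Countable (Phase T) := by
  refine Function.Injective.countable (β := Option (Option (Fin T)))
    (f := fun | .idle => none | .triggered => some none | .monitoring r => some (some r)) ?_
  intro a b h
  cases a <;> cases b <;> simp_all

instance : Countable (State T d) := by
  refine Function.Injective.countable (β := Fin d × ℕ × ℕ × Phase T)
    (f := fun s => (s.expert, s.switches, s.start, s.phase)) ?_
  rintro ⟨⟩ ⟨⟩ h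
  simp_all

/-- All sets of states are measurable. -/
instance : MeasurableSpace (State T d) := ⊤

instance : DiscreteMeasurableSpace (State T d) := ⟨fun _ => trivial⟩

/-- The sequence of all states that the algorithm passes through. -/
abbrev Transcript (T d : ℕ) : Type := Fin (T + 1) → State T d

/-- The state before the first round. -/
def initialState (T : ℕ) {d : ℕ} (x₀ : Fin d) : State T d :=
  { expert := x₀, switches := 0, start := 0, phase := .idle }

/-- The transcript of the algorithm as a function of its randomness. -/
def run (K L : ℝ) (ℓ : Losses T d) (p : Fin d × (Fin T → Seed d)) : Transcript T d :=
  fun n => stateAfter K L ℓ p.1 p.2 n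

/-- The noise of the thresholds and the noise of the queries, in all rounds. -/
abbrev Noise (T : ℕ) : Type := (Fin T → ℝ) × (Fin T → ℝ)

/-- The seeds made up of given noise and given outcomes of the exponential mechanism. -/
def assemble (z : Noise T) (y : Fin T → Fin d) : Fin T → Seed d := fun t => (z.1 t, z.2 t, y t)

/-- The rounds of a transcript in which a new expert is sampled. -/
def switchRounds (σ : Transcript T d) : Finset (Fin T) :=
  open Classical in {t | (σ t.castSucc).phase = .triggered}

lemma mem_switchRounds {σ : Transcript T d} {t : Fin T} :
    t ∈ switchRounds σ ↔ (σ t.castSucc).phase = .triggered := by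
  simp [switchRounds]

/-- The noise under which the instances of AboveThreshold give the answers recorded in the
transcript `σ`, if the experts are those recorded in `σ`. -/
def consistentNoise (K L : ℝ) (ℓ : Losses T d) (σ : Transcript T d) : Set (Noise T) :=
  {z | ∀ t, step K L ℓ (assemble z fun t => (σ t.succ).expert) t (σ t.castSucc) = σ t.succ}

lemma stateAfter_succ (K L : ℝ) (ℓ : Losses T d) (x₀ : Fin d) (ω : Fin T → Seed d) (t : Fin T) :
    stateAfter K L ℓ x₀ ω (t + 1) = step K L ℓ ω t (stateAfter K L ℓ x₀ ω t) := by
  simp [stateAfter]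

lemma run_eq_iff_step (K L : ℝ) (ℓ : Losses T d) (x₀ : Fin d) (ω : Fin T → Seed d)
    (σ : Transcript T d) :
    run K L ℓ (x₀, ω) = σ ↔
      initialState T x₀ = σ 0 ∧ ∀ t, step K L ℓ ω t (σ t.castSucc) = σ t.succ := by
  constructor
  · rintro rfl
    refine ⟨rfl, fun t => ?_⟩
    simp [run, stateAfter_succ]
  · rintro ⟨h0, h⟩
    funext n
    induction n using Fin.induction with
    | zero => exact h0
    | succ t ih =>
      rw [← h t, ← ih]
      simp [run, stateAfter_succ]

lemma step_eq_iff (K L : ℝ) (ℓ : Losses T d) (z : Noise T) (y : Fin T → Fin d)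
    (σ : Transcript T d) (t : Fin T) :
    step K L ℓ (assemble z y) t (σ t.castSucc) = σ t.succ ↔
      step K L ℓ (assemble z fun t => (σ t.succ).expert) t (σ t.castSucc) = σ t.succ ∧
        (t ∈ switchRounds σ → y t = (σ t.succ).expert) := by
  rw [mem_switchRounds]
  cases h : (σ t.castSucc).phase with
  | triggered =>
    simp only [step, h, assemble, forall_const]
    constructor
    · intro h'
      rw [← h']
      simp
    · rintro ⟨h1, h2⟩
      rw [h2]
      exact h1
  | idle =>
    have : step K L ℓ (assemble z y) t (σ t.castSucc) =
        step K L ℓ (assemble z fun t => (σ t.succ).expert) t (σ t.castSucc) := by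
      simp only [step, h]; rfl
    simp [this]
  | monitoring r =>
    have : step K L ℓ (assemble z y) t (σ t.castSucc) =
        step K L ℓ (assemble z fun t => (σ t.succ).expert) t (σ t.castSucc) := by
      simp only [step, h]; rfl
    simp [this]

lemma run_eq_iff (K L : ℝ) (ℓ : Losses T d) (x₀ : Fin d) (z : Noise T) (y : Fin T → Fin d)
    (σ : Transcript T d) :
    run K L ℓ (x₀, assemble z y) = σ ↔
      initialState T x₀ = σ 0 ∧ z ∈ consistentNoise K L ℓ σ ∧
        ∀ t ∈ switchRounds σ, y t = (σ t.succ).expert := by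
  rw [run_eq_iff_step]
  refine and_congr_right fun _ => ?_
  exact (forall_congr' fun t => step_eq_iff K L ℓ z y σ t).trans forall_and

lemma measurableSet_consistentNoise (K L : ℝ) (ℓ : Losses T d) (σ : Transcript T d) :
    MeasurableSet (consistentNoise K L ℓ σ) := by
  have hite : ∀ (P : Noise T → Prop) (_ : ∀ z, Decidable (P z)) (a b c : State T d)
      (_ : MeasurableSet {z | P z}), MeasurableSet {z | (if P z then a else b) = c} := by
    intro P _ a b c hP
    have : {z | (if P z then a else b) = c} =
        ({z | P z} ∩ {_z | a = c}) ∪ ({z | P z}ᶜ ∩ {_z | b = c}) := by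
      ext z
      by_cases h : P z <;> simp [h]
    rw [this]
    exact (hP.inter (.const _)).union (hP.compl.inter (.const _))
  have hask : ∀ t r : Fin T, MeasurableSet {z : Noise T | askQuery L ℓ
      (assemble z fun t => (σ t.succ).expert) t r (σ t.castSucc) = σ t.succ} := by
    intro t r
    have : ∀ z : Noise T, askQuery L ℓ (assemble z fun t => (σ t.succ).expert) t r (σ t.castSucc) =
        if L + z.1 r ≤ lossBetween ℓ (σ t.castSucc).start t (σ t.castSucc).expert + z.2 t then
          { σ t.castSucc with phase := .triggered } else
          { σ t.castSucc with phase := .monitoring r } := by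
      intro z
      exact apply_ite (fun φ => { σ t.castSucc with phase := φ })
        (L + z.1 r ≤ lossBetween ℓ (σ t.castSucc).start t (σ t.castSucc).expert + z.2 t)
        .triggered (.monitoring r)
    simp only [this]
    refine hite _ _ _ _ _ (measurableSet_le ?_ ?_) <;> fun_prop
  unfold consistentNoise
  rw [Set.ofPred_forall]
  refine MeasurableSet.iInter fun t => ?_
  cases h : (σ t.castSucc).phase with
  | triggered => simp only [step, h, assemble]; exact .const _
  | idle =>
    simp only [step, h]
    split_ifs
    · exact hask t t
    · exact .const _
  | monitoring r => simp only [step, h]; exact hask t r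

/-! ### The law of the transcript -/

/-- The law of the randomness with Laplace noise of scales `b₁` (thresholds) and `b₂` (queries),
if the expert sampled in round `t` has law `p t`. -/
def seedLaw [NeZero d] (b₁ b₂ : ℝ) (p : Fin T → PMF (Fin d)) :
    Measure (Fin d × (Fin T → Seed d)) :=
  (PMF.uniformOfFintype (Fin d)).toMeasure.prod
    (Measure.pi fun t : Fin T =>
      (laplace b₁).prod ((laplace b₂).prod (p t).toMeasure))

/-- The law of the noise, with scale `b₁` for thresholds and `b₂` for queries. -/
def noiseLaw (T : ℕ) (b₁ b₂ : ℝ) : Measure (Noise T) :=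
  (Measure.pi fun _ => laplace b₁).prod (Measure.pi fun _ => laplace b₂)

lemma isProbabilityMeasure_noiseLaw (T : ℕ) {b₁ b₂ : ℝ} (hb₁ : 0 < b₁) (hb₂ : 0 < b₂) :
    IsProbabilityMeasure (noiseLaw T b₁ b₂) := by
  have := isProbabilityMeasure_laplace hb₁
  have := isProbabilityMeasure_laplace hb₂
  unfold noiseLaw
  infer_instance

/-- The law of the transcript, if the expert sampled in round `t` has law `p t`. -/
def transcriptLaw [NeZero d] (K L : ℝ) (ℓ : Losses T d) (b₁ b₂ : ℝ) (p : Fin T → PMF (Fin d)) :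
    Measure (Transcript T d) :=
  (seedLaw b₁ b₂ p).map (run K L ℓ)

/-- Splits the randomness into the initial expert, the noise, and the outcomes of the exponential
mechanism. -/
def splitSeeds (p : Fin d × (Fin T → Seed d)) : Fin d × (Noise T × (Fin T → Fin d)) :=
  (p.1, (fun t => (p.2 t).1, fun t => (p.2 t).2.1), fun t => (p.2 t).2.2)

lemma measurePreserving_splitSeeds [NeZero d] {b₁ b₂ : ℝ} (hb₁ : 0 < b₁) (hb₂ : 0 < b₂)
    (p : Fin T → PMF (Fin d)) :
    MeasurePreserving splitSeeds (seedLaw b₁ b₂ p)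
      ((PMF.uniformOfFintype (Fin d)).toMeasure.prod
        ((noiseLaw T b₁ b₂).prod (Measure.pi fun t => (p t).toMeasure))) := by
  have := isProbabilityMeasure_laplace hb₁
  have := isProbabilityMeasure_laplace hb₂
  have h1 := measurePreserving_arrowProdEquivProdArrow ℝ (ℝ × Fin d) (Fin T)
    (fun _ => laplace b₁) (fun t => (laplace b₂).prod (p t).toMeasure)
  have h2 := measurePreserving_arrowProdEquivProdArrow ℝ (Fin d) (Fin T)
    (fun _ => laplace b₂) (fun t => (p t).toMeasure)
  have h3 := ((MeasurePreserving.id (Measure.pi fun _ : Fin T => laplace b₁)).prod h2).comp h1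
  have h4 := (measurePreserving_prodAssoc (Measure.pi fun _ : Fin T => laplace b₁)
    (Measure.pi fun _ : Fin T => laplace b₂) (Measure.pi fun t => (p t).toMeasure)).symm.comp h3
  exact (MeasurePreserving.id (PMF.uniformOfFintype (Fin d)).toMeasure).prod h4

lemma run_eq_comp_splitSeeds (K L : ℝ) (ℓ : Losses T d) :
    run K L ℓ = (fun q => run K L ℓ (q.1, assemble q.2.1 q.2.2)) ∘ splitSeeds := rfl

lemma preimage_run_eq (K L : ℝ) (ℓ : Losses T d) (σ : Transcript T d) :
    (fun q : Fin d × (Noise T × (Fin T → Fin d)) => run K L ℓ (q.1, assemble q.2.1 q.2.2)) ⁻¹' {σ} =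
      {x₀ | initialState T x₀ = σ 0} ×ˢ (consistentNoise K L ℓ σ ×ˢ
        Set.univ.pi fun t => {y | t ∈ switchRounds σ → y = (σ t.succ).expert}) := by
  ext ⟨x₀, z, y⟩
  simp only [Set.mem_preimage, Set.mem_singleton_iff, run_eq_iff, Set.mem_prod, Set.mem_ofPred_eq,
    Set.mem_pi, Set.mem_univ, forall_const]

lemma measurable_run_split (K L : ℝ) (ℓ : Losses T d) :
    Measurable fun q : Fin d × (Noise T × (Fin T → Fin d)) =>
      run K L ℓ (q.1, assemble q.2.1 q.2.2) := by
  refine measurable_to_countable' fun σ => ?_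
  rw [preimage_run_eq]
  exact (Set.toFinite _).measurableSet.prod ((measurableSet_consistentNoise K L ℓ σ).prod
    (.univ_pi fun t => (Set.toFinite _).measurableSet))

lemma measurable_run (K L : ℝ) (ℓ : Losses T d) : Measurable (run K L ℓ) := by
  rw [run_eq_comp_splitSeeds]
  refine (measurable_run_split K L ℓ).comp ?_
  unfold splitSeeds
  fun_prop

/-- The probability of a transcript factorizes: the answers of AboveThreshold depend on the noise
alone, and the law of the experts enters only through the rounds in which an expert is sampled. -/
lemma transcriptLaw_singleton [NeZero d] (K L : ℝ) (ℓ : Losses T d) {b₁ b₂ : ℝ} (hb₁ : 0 < b₁)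
    (hb₂ : 0 < b₂) (p : Fin T → PMF (Fin d)) (σ : Transcript T d) :
    transcriptLaw K L ℓ b₁ b₂ p {σ} =
      (PMF.uniformOfFintype (Fin d)).toMeasure {x₀ | initialState T x₀ = σ 0} *
        noiseLaw T b₁ b₂ (consistentNoise K L ℓ σ) *
        ∏ t ∈ switchRounds σ, p t (σ t.succ).expert := by
  have := isProbabilityMeasure_laplace hb₁
  have := isProbabilityMeasure_laplace hb₂
  have := isProbabilityMeasure_noiseLaw T hb₁ hb₂
  unfold transcriptLaw
  rw [run_eq_comp_splitSeeds, ← Measure.map_map (measurable_run_split K L ℓ)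
    (measurePreserving_splitSeeds hb₁ hb₂ p).measurable,
    (measurePreserving_splitSeeds hb₁ hb₂ p).map_eq,
    Measure.map_apply (measurable_run_split K L ℓ) (measurableSet_singleton σ), preimage_run_eq,
    Measure.prod_prod, Measure.prod_prod, Measure.pi_pi, ← mul_assoc]
  congr 1
  rw [← Finset.prod_subset (Finset.subset_univ (switchRounds σ))]
  · refine Finset.prod_congr rfl fun t ht => ?_
    simp only [ht, forall_const, Set.ofPred_eq_eq_singleton]
    exact PMF.toMeasure_apply_singleton _ _ (measurableSet_singleton _)
  · intro t _ ht
    simp [ht]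

lemma isProbabilityMeasure_transcriptLaw [NeZero d] (K L : ℝ) (ℓ : Losses T d) {b₁ b₂ : ℝ}
    (hb₁ : 0 < b₁) (hb₂ : 0 < b₂) (p : Fin T → PMF (Fin d)) :
    IsProbabilityMeasure (transcriptLaw K L ℓ b₁ b₂ p) := by
  have := isProbabilityMeasure_laplace hb₁
  have := isProbabilityMeasure_laplace hb₂
  have : IsProbabilityMeasure (seedLaw b₁ b₂ p) := by unfold seedLaw; infer_instance
  exact Measure.isProbabilityMeasure_map (measurable_run K L ℓ).aemeasurable

/-- A sub-probability vector `p * g` is dominated by a probability vector: the missing mass is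
placed at an arbitrary point. -/
lemma exists_pmf_mul_le [NeZero d] (p : PMF (Fin d)) (g : Fin d → ENNReal)
    (h : ∑ x, p x * g x ≤ 1) : ∃ q : PMF (Fin d), ∀ x, p x * g x ≤ q x := by
  refine ⟨PMF.ofFintype (fun x => p x * g x + if x = 0 then 1 - ∑ x, p x * g x else 0) ?_, ?_⟩
  · rw [Finset.sum_add_distrib, Finset.sum_ite_eq' Finset.univ]
    simpa using add_tsub_cancel_of_le h
  · intro x
    simp [PMF.ofFintype_apply]

/-- If each `g t` is a sub-probability density with respect to the law of the expert sampled in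
round `t`, then the product of the `g t` over the rounds in which an expert is sampled has
expectation at most one: it is dominated by the density of the law of the transcript for other
laws of the experts. -/
lemma lintegral_prod_switchRounds_le_one [NeZero d] (K L : ℝ) (ℓ : Losses T d) {b₁ b₂ : ℝ}
    (hb₁ : 0 < b₁) (hb₂ : 0 < b₂) (p : Fin T → PMF (Fin d)) (g : Fin T → Fin d → ENNReal)
    (hg : ∀ t, ∑ x, p t x * g t x ≤ 1) :
    ∫⁻ σ, ∏ t ∈ switchRounds σ, g t (σ t.succ).expert ∂transcriptLaw K L ℓ b₁ b₂ p ≤ 1 := by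
  choose q hq using fun t => exists_pmf_mul_le (p t) (g t) (hg t)
  have := isProbabilityMeasure_transcriptLaw K L ℓ hb₁ hb₂ q
  calc _ ≤ ∫⁻ _σ, 1 ∂transcriptLaw K L ℓ b₁ b₂ q := by
        rw [lintegral_countable', lintegral_countable']
        refine ENNReal.tsum_le_tsum fun σ => ?_
        rw [transcriptLaw_singleton K L ℓ hb₁ hb₂, transcriptLaw_singleton K L ℓ hb₁ hb₂,
          mul_left_comm, ← Finset.prod_mul_distrib, one_mul]
        gcongr with t
        rw [mul_comm]
        exact hq _ _
    _ = 1 := by simp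

/-! ### Dynamics of the states -/

/-- In round `n`, a query of the instance of AboveThreshold that was initialized in round `r` is
asked. -/
def Querying (K : ℝ) (s : State T d) (n : ℕ) (r : Fin T) : Prop :=
  s.phase = .monitoring r ∨ s.phase = .idle ∧ (s.switches : ℝ) < K ∧ (r : ℕ) = n

lemma Querying.phase_ne_triggered {K : ℝ} {s : State T d} {n : ℕ} {r : Fin T}
    (h : Querying K s n r) : s.phase ≠ .triggered := by
  rcases h with h | ⟨h, -⟩ <;> simp [h]

lemma Querying.unique {K : ℝ} {s : State T d} {n : ℕ} {r r' : Fin T}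
    (h : Querying K s n r) (h' : Querying K s n r') : r = r' := by
  rcases h with h | ⟨h, -, hr⟩ <;> rcases h' with h' | ⟨h', -, hr'⟩
  · simpa [h] using h'
  · simp [h] at h'
  · simp [h] at h'
  · exact Fin.ext (by omega)

lemma Querying.not_stopped {K : ℝ} {s : State T d} {n : ℕ} {r : Fin T}
    (h : Querying K s n r) : ¬(s.phase = .idle ∧ ¬(s.switches : ℝ) < K) := by
  rintro ⟨h1, h2⟩
  rcases h with h | ⟨-, h, -⟩
  · simp [h] at h1
  · exact h2 h

lemma Querying.step_eq {K L : ℝ} {ℓ : Losses T d} {ω : Fin T → Seed d} {t r : Fin T}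
    {s : State T d} (h : Querying K s t r) : step K L ℓ ω t s = askQuery L ℓ ω t r s := by
  rcases h with h | ⟨h, hk, hr⟩
  · simp [step, h]
  · obtain rfl := Fin.ext hr
    simp [step, h, hk]

lemma triggered_or_querying_or_stopped (K : ℝ) (s : State T d) (t : Fin T) :
    s.phase = .triggered ∨ (∃ r, Querying K s t r) ∨ (s.phase = .idle ∧ ¬(s.switches : ℝ) < K) := by
  cases h : s.phase with
  | triggered => simp
  | monitoring r => exact .inr (.inl ⟨r, .inl h⟩)
  | idle =>
    by_cases hk : (s.switches : ℝ) < K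
    · exact .inr (.inl ⟨t, .inr ⟨h, hk, rfl⟩⟩)
    · exact .inr (.inr ⟨rfl, hk⟩)

lemma step_of_triggered {K L : ℝ} {ℓ : Losses T d} {ω : Fin T → Seed d} {t : Fin T}
    {s : State T d} (h : s.phase = .triggered) :
    step K L ℓ ω t s =
      { expert := (ω t).2.2, switches := s.switches + 1, start := t, phase := .idle } := by
  simp [step, h]

lemma step_of_stopped {K L : ℝ} {ℓ : Losses T d} {ω : Fin T → Seed d} {t : Fin T}
    {s : State T d} (h : s.phase = .idle ∧ ¬(s.switches : ℝ) < K) : step K L ℓ ω t s = s := by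
  simp [step, h.1, h.2]

lemma askQuery_of_le {L : ℝ} {ℓ : Losses T d} {ω : Fin T → Seed d} {t r : Fin T} {s : State T d}
    (h : L + (ω r).1 ≤ lossBetween ℓ s.start t s.expert + (ω t).2.1) :
    askQuery L ℓ ω t r s = { s with phase := .triggered } := by
  simp [askQuery, h]

lemma askQuery_of_lt {L : ℝ} {ℓ : Losses T d} {ω : Fin T → Seed d} {t r : Fin T} {s : State T d}
    (h : lossBetween ℓ s.start t s.expert + (ω t).2.1 < L + (ω r).1) :
    askQuery L ℓ ω t r s = { s with phase := .monitoring r } := by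
  simp [askQuery, h.not_ge]

/-- An induction principle for the states: in each round a new expert is sampled, or a query is
answered positively or negatively, or the algorithm has stopped asking queries. -/
lemma stateAfter_induction {K L : ℝ} {ℓ : Losses T d} {x₀ : Fin d} {ω : Fin T → Seed d}
    {P : ℕ → State T d → Prop} (m : ℕ) (hm : P m (stateAfter K L ℓ x₀ ω m))
    (hsample : ∀ (t : Fin T) (s : State T d), m ≤ t → s = stateAfter K L ℓ x₀ ω t → P t s →
      s.phase = .triggered → P (t + 1)
        { expert := (ω t).2.2, switches := s.switches + 1, start := t, phase := .idle })
    (habove : ∀ (t r : Fin T) (s : State T d), m ≤ t → s = stateAfter K L ℓ x₀ ω t → P t s →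
      Querying K s t r → L + (ω r).1 ≤ lossBetween ℓ s.start t s.expert + (ω t).2.1 →
      P (t + 1) { s with phase := .triggered })
    (hbelow : ∀ (t r : Fin T) (s : State T d), m ≤ t → s = stateAfter K L ℓ x₀ ω t → P t s →
      Querying K s t r → lossBetween ℓ s.start t s.expert + (ω t).2.1 < L + (ω r).1 →
      P (t + 1) { s with phase := .monitoring r })
    (hidle : ∀ (t : Fin T) (s : State T d), m ≤ t → s = stateAfter K L ℓ x₀ ω t → P t s →
      s.phase = .idle ∧ ¬(s.switches : ℝ) < K → P (t + 1) s)
    (n : ℕ) (hmn : m ≤ n) (hn : n ≤ T) : P n (stateAfter K L ℓ x₀ ω n) := by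
  induction n, hmn using Nat.le_induction with
  | base => exact hm
  | succ n hmn ih =>
    have ih := ih (by omega)
    lift n to Fin T using hn
    rw [stateAfter_succ]
    rcases triggered_or_querying_or_stopped K (stateAfter K L ℓ x₀ ω n) n with h | ⟨r, h⟩ | h
    · rw [step_of_triggered h]
      exact hsample n _ hmn rfl ih h
    · rw [h.step_eq]
      rcases le_or_gt (L + (ω r).1) (lossBetween ℓ (stateAfter K L ℓ x₀ ω n).start n
        (stateAfter K L ℓ x₀ ω n).expert + (ω n).2.1) with hle | hlt
      · rw [askQuery_of_le hle]
        exact habove n r _ hmn rfl ih h hle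
      · rw [askQuery_of_lt hlt]
        exact hbelow n r _ hmn rfl ih h hlt
    · rw [step_of_stopped h]
      exact hidle n _ hmn rfl ih h

section

variable {K L : ℝ} {ℓ : Losses T d} {x₀ : Fin d} {ω : Fin T → Seed d}

lemma Querying.instance_le {n : ℕ} (hn : n ≤ T) {r : Fin T}
    (h : Querying K (stateAfter K L ℓ x₀ ω n) n r) : (r : ℕ) ≤ n := by
  have key : ∀ r, (stateAfter K L ℓ x₀ ω n).phase = .monitoring r → (r : ℕ) < n := by
    refine stateAfter_induction (P := fun n s => ∀ r, s.phase = .monitoring r → (r : ℕ) < n)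
      0 ?_ ?_ ?_ ?_ ?_ n n.zero_le hn
    · simp [stateAfter]
    · simp
    · simp
    · rintro t r s - - hP hq - r' hr'
      simp only [Phase.monitoring.injEq] at hr'
      subst hr'
      rcases hq with hq | ⟨-, -, hq⟩
      · exact (hP r hq).trans (Nat.lt_succ_self _)
      · omega
    · rintro t s - - hP hs r hr
      simp [hs.1] at hr
  rcases h with h | ⟨-, -, h⟩
  · exact (key r h).le
  · exact h.le

/-- After a positive answer, reported before round `n`, the queries count only losses from round
`n` on and belong to instances that are initialized later. -/
lemma lt_instance_of_triggered {n m : ℕ} (hnm : n < m) (hm : m ≤ T)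
    (h : (stateAfter K L ℓ x₀ ω n).phase = .triggered) :
    n ≤ (stateAfter K L ℓ x₀ ω m).start ∧
      ∀ r, Querying K (stateAfter K L ℓ x₀ ω m) m r → n < r := by
  have key : n ≤ (stateAfter K L ℓ x₀ ω m).start ∧
      ∀ r, (stateAfter K L ℓ x₀ ω m).phase = .monitoring r → n < r := by
    refine stateAfter_induction
      (P := fun m s => n ≤ s.start ∧ ∀ r, s.phase = .monitoring r → n < r)
      (n + 1) ?_ ?_ ?_ ?_ ?_ m hnm hm
    · have := stateAfter_succ K L ℓ x₀ ω ⟨n, by omega⟩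
      simp only at this
      rw [this, step_of_triggered h]
      simp
    · rintro t s ht - - -
      exact ⟨by simp only; omega, by simp⟩
    · rintro t r s - - hP - -
      exact ⟨hP.1, by simp⟩
    · rintro t r s ht - hP hq -
      refine ⟨hP.1, fun r' hr' => ?_⟩
      simp only [Phase.monitoring.injEq] at hr'
      subst hr'
      rcases hq with hq | ⟨-, -, hq⟩
      · exact hP.2 r hq
      · omega
    · rintro t s - - hP hs
      exact hP
  refine ⟨key.1, fun r hr => ?_⟩
  rcases hr with hr | ⟨-, -, hr⟩
  · exact key.2 r hr
  · omega

/-- After a round `m` in which a query is asked, the queries either belong to the same instance of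
AboveThreshold or to one that is initialized later and counts only losses from round `m` on. -/
lemma Querying.same_or_later {m n : ℕ} (hmn : m ≤ n) (hn : n ≤ T) {r₀ r : Fin T}
    (h₀ : Querying K (stateAfter K L ℓ x₀ ω m) m r₀)
    (h : Querying K (stateAfter K L ℓ x₀ ω n) n r) :
    ((stateAfter K L ℓ x₀ ω n).start = (stateAfter K L ℓ x₀ ω m).start ∧
      (stateAfter K L ℓ x₀ ω n).expert = (stateAfter K L ℓ x₀ ω m).expert ∧ r = r₀) ∨
    (m ≤ (stateAfter K L ℓ x₀ ω n).start ∧ m < r) := by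
  set s₀ := stateAfter K L ℓ x₀ ω m with hs₀
  have key : ((stateAfter K L ℓ x₀ ω n).start = s₀.start ∧
        (stateAfter K L ℓ x₀ ω n).expert = s₀.expert ∧
        (n = m ∨ (stateAfter K L ℓ x₀ ω n).phase = .triggered ∨
          (stateAfter K L ℓ x₀ ω n).phase = .monitoring r₀)) ∨
      (m < n ∧ m ≤ (stateAfter K L ℓ x₀ ω n).start ∧
        ∀ r, (stateAfter K L ℓ x₀ ω n).phase = .monitoring r → m < r) := by
    refine stateAfter_induction
      (P := fun n s => (s.start = s₀.start ∧ s.expert = s₀.expert ∧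
          (n = m ∨ s.phase = .triggered ∨ s.phase = .monitoring r₀)) ∨
        (m < n ∧ m ≤ s.start ∧ ∀ r, s.phase = .monitoring r → m < r))
      m ?_ ?_ ?_ ?_ ?_ n hmn hn
    · exact .inl ⟨rfl, rfl, .inl rfl⟩
    · rintro t s ht - - -
      exact .inr ⟨by omega, by simpa using ht, by simp⟩
    · rintro t r s ht - hP hq -
      rcases hP with hP | hP
      · exact .inl ⟨hP.1, hP.2.1, .inr (.inl rfl)⟩
      · exact .inr ⟨by omega, hP.2.1, by simp⟩
    · rintro t r s ht hs hP hq -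
      rcases hP with hP | hP
      · refine .inl ⟨hP.1, hP.2.1, .inr (.inr ?_)⟩
        simp only [Phase.monitoring.injEq]
        rcases hP.2.2 with h | h | h
        · rw [h, ← hs₀] at hs
          rw [h, hs] at hq
          exact hq.unique h₀
        · exact absurd h hq.phase_ne_triggered
        · rcases hq with hq | ⟨hq, -⟩
          · simpa [h] using hq.symm
          · simp [h] at hq
      · refine .inr ⟨by omega, hP.2.1, fun r' hr' => ?_⟩
        simp only [Phase.monitoring.injEq] at hr'
        subst hr'
        rcases hq with hq | ⟨-, -, hq⟩
        · exact hP.2.2 r hq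
        · omega
    · rintro t s ht hs hP hst
      rcases hP with hP | hP
      · rcases hP.2.2 with h | h | h
        · rw [h, ← hs₀] at hs
          subst hs
          exact absurd hst h₀.not_stopped
        · simp [hst.1] at h
        · simp [hst.1] at h
      · exact .inr ⟨by omega, hP.2⟩
  rcases key with hP | hP
  · refine .inl ⟨hP.1, hP.2.1, ?_⟩
    rcases hP.2.2 with h' | h' | h'
    · rw [h'] at h
      exact h.unique h₀
    · exact absurd h' h.phase_ne_triggered
    · rcases h with h | ⟨h, -⟩
      · simpa [h'] using h.symm
      · simp [h'] at h
  · refine .inr ⟨hP.2.1, ?_⟩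
    rcases h with h | ⟨-, -, h⟩
    · exact hP.2.2 r h
    · omega

/-- If no query that counts the loss of round `i` is asked in round `i + 1`, then none is asked
later. -/
lemma Querying.lt_start_of_not_querying {i n : ℕ} (hin : i + 1 ≤ n) (hn : n ≤ T) {r : Fin T}
    (h₀ : ¬∃ r₀, Querying K (stateAfter K L ℓ x₀ ω (i + 1)) (i + 1) r₀ ∧
      (stateAfter K L ℓ x₀ ω (i + 1)).start ≤ i)
    (h : Querying K (stateAfter K L ℓ x₀ ω n) n r) : i < (stateAfter K L ℓ x₀ ω n).start := by
  have hstart : ∀ (t r : Fin T) (s : State T d), s = stateAfter K L ℓ x₀ ω t → (i < s.start ∨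
      (s.phase = .idle ∧ ¬(s.switches : ℝ) < K) ∨ (t : ℕ) = i + 1) → Querying K s t r →
      i < s.start := by
    rintro t r s hs (hP | hP | hP) hq
    · exact hP
    · exact absurd hP hq.not_stopped
    · rw [hP] at hs hq
      subst hs
      exact not_le.1 fun h' => h₀ ⟨r, hq, h'⟩
  have key : i < (stateAfter K L ℓ x₀ ω n).start ∨
      ((stateAfter K L ℓ x₀ ω n).phase = .idle ∧ ¬((stateAfter K L ℓ x₀ ω n).switches : ℝ) < K) ∨
      n = i + 1 := by
    refine stateAfter_induction (P := fun n s => i < s.start ∨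
      (s.phase = .idle ∧ ¬(s.switches : ℝ) < K) ∨ n = i + 1) (i + 1) ?_ ?_ ?_ ?_ ?_ n hin hn
    · simp
    · rintro t s ht - - -
      exact .inl (by simp only; omega)
    · rintro t r s - hs hP hq -
      exact .inl (hstart t r s hs hP hq)
    · rintro t r s - hs hP hq -
      exact .inl (hstart t r s hs hP hq)
    · rintro t s - - - hst
      exact .inr (.inl hst)
  rcases key with hP | hP | hP
  · exact hP
  · exact absurd hP h.not_stopped
  · rw [hP] at h ⊢
    exact not_le.1 fun h' => h₀ ⟨r, h, h'⟩

end

/-! ### Privacy of AboveThreshold -/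

lemma lossBetween_of_neighbor {ℓ ℓ' : Losses T d} {i : Fin T} (h : ∀ j, j ≠ i → ℓ j = ℓ' j)
    (s t : ℕ) (x : Fin d) : lossBetween ℓ' s t x = lossBetween ℓ s t x +
      if s ≤ (i : ℕ) ∧ (i : ℕ) < t then (ℓ' i x - ℓ i x : ℝ) else 0 := by
  unfold lossBetween
  rw [Finset.sum_filter, Finset.sum_filter, ← sub_eq_iff_eq_add', ← Finset.sum_sub_distrib,
    Finset.sum_eq_single i]
  · split_ifs <;> simp
  · intro j _ hj
    rw [h j hj]
    simp
  · simp

lemma exists_run_of_mem_consistentNoise {K L : ℝ} {ℓ : Losses T d} {σ : Transcript T d}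
    {z : Noise T} (hz : z ∈ consistentNoise K L ℓ σ) {x₀ : Fin d} (h₀ : initialState T x₀ = σ 0) :
    ∃ ω, (∀ t, (ω t).1 = z.1 t) ∧ (∀ t, (ω t).2.1 = z.2 t) ∧ run K L ℓ (x₀, ω) = σ :=
  ⟨assemble z fun t => (σ t.succ).expert, fun _ => rfl, fun _ => rfl,
    (run_eq_iff_step ..).2 ⟨h₀, hz⟩⟩

/-- Noise under which every query receives the same answer is consistent with the same
transcript. -/
lemma mem_consistentNoise_of_same_answers {K L : ℝ} {ℓ ℓ' : Losses T d} {σ : Transcript T d}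
    {z z' : Noise T} (hz : z ∈ consistentNoise K L ℓ σ)
    (habove : ∀ t r : Fin T, Querying K (σ t.castSucc) t r → (σ t.succ).phase = .triggered →
      L + z.1 r ≤ lossBetween ℓ (σ t.castSucc).start t (σ t.castSucc).expert + z.2 t →
      L + z'.1 r ≤ lossBetween ℓ' (σ t.castSucc).start t (σ t.castSucc).expert + z'.2 t)
    (hbelow : ∀ t r : Fin T, Querying K (σ t.castSucc) t r → (σ t.succ).phase ≠ .triggered →
      lossBetween ℓ (σ t.castSucc).start t (σ t.castSucc).expert + z.2 t < L + z.1 r →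
      lossBetween ℓ' (σ t.castSucc).start t (σ t.castSucc).expert + z'.2 t < L + z'.1 r) :
    z' ∈ consistentNoise K L ℓ' σ := by
  intro t
  have hzt := hz t
  rcases triggered_or_querying_or_stopped K (σ t.castSucc) t with h | ⟨r, h⟩ | h
  · rw [step_of_triggered h] at hzt ⊢
    exact hzt
  · rw [h.step_eq] at hzt ⊢
    rcases le_or_gt (L + z.1 r)
      (lossBetween ℓ (σ t.castSucc).start t (σ t.castSucc).expert + z.2 t) with hle | hlt
    · rw [askQuery_of_le hle] at hzt
      rw [askQuery_of_le (habove t r h (by rw [← hzt]) hle)]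
      exact hzt
    · rw [askQuery_of_lt hlt] at hzt
      rw [askQuery_of_lt (hbelow t r h (by rw [← hzt]; simp) hlt)]
      exact hzt
  · rw [step_of_stopped h] at hzt ⊢
    exact hzt

/-- If a translation of the noise of one threshold by `a` maps `N` into `N'`, then `N` is at most
`exp (|a| / b₁)` times as likely as `N'`. -/
lemma noiseLaw_le_of_shift_threshold {b₁ b₂ : ℝ} (hb₁ : 0 < b₁) (hb₂ : 0 < b₂) (r : Fin T) (a : ℝ)
    {N N' : Set (Noise T)} (hN' : MeasurableSet N')
    (h : ∀ z ∈ N, (Function.update z.1 r (z.1 r + a), z.2) ∈ N') :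
    noiseLaw T b₁ b₂ N ≤ ENNReal.ofReal (Real.exp (|a| / b₁)) * noiseLaw T b₁ b₂ N' := by
  have := isProbabilityMeasure_laplace hb₁
  have := isProbabilityMeasure_laplace hb₂
  have hm := measurable_update_add r a
  have := Measure.isProbabilityMeasure_map (μ := Measure.pi fun _ : Fin T => laplace b₁)
    hm.aemeasurable
  calc noiseLaw T b₁ b₂ N
      ≤ noiseLaw T b₁ b₂ (Prod.map (fun z => Function.update z r (z r + a)) id ⁻¹' N') :=
        measure_mono h
    _ = (((Measure.pi fun _ => laplace b₁).map fun z => Function.update z r (z r + a)).prod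
          ((Measure.pi fun _ => laplace b₂).map id)) N' := by
        rw [Measure.map_prod_map _ _ hm measurable_id,
          Measure.map_apply (hm.prodMap measurable_id) hN']
        rfl
    _ ≤ ((ENNReal.ofReal (Real.exp (|a| / b₁)) • Measure.pi fun _ => laplace b₁).prod
          (Measure.pi fun _ => laplace b₂)) N' := by
        rw [Measure.map_id]
        exact Measure.prod_mono (pi_laplace_map_update_le hb₁ r a) le_rfl N'
    _ = _ := by
        rw [Measure.prod_smul_left]
        rfl

/-- If a translation of the noise of one query by `a` maps `N` into `N'`, then `N` is at most
`exp (|a| / b₂)` times as likely as `N'`. -/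
lemma noiseLaw_le_of_shift_query {b₁ b₂ : ℝ} (hb₁ : 0 < b₁) (hb₂ : 0 < b₂) (t : Fin T) (a : ℝ)
    {N N' : Set (Noise T)} (hN' : MeasurableSet N')
    (h : ∀ z ∈ N, (z.1, Function.update z.2 t (z.2 t + a)) ∈ N') :
    noiseLaw T b₁ b₂ N ≤ ENNReal.ofReal (Real.exp (|a| / b₂)) * noiseLaw T b₁ b₂ N' := by
  have := isProbabilityMeasure_laplace hb₁
  have := isProbabilityMeasure_laplace hb₂
  have hm := measurable_update_add t a
  have := Measure.isProbabilityMeasure_map (μ := Measure.pi fun _ : Fin T => laplace b₂)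
    hm.aemeasurable
  calc noiseLaw T b₁ b₂ N
      ≤ noiseLaw T b₁ b₂ (Prod.map id (fun z => Function.update z t (z t + a)) ⁻¹' N') :=
        measure_mono h
    _ = (((Measure.pi fun _ => laplace b₁).map id).prod
          ((Measure.pi fun _ => laplace b₂).map fun z => Function.update z t (z t + a))) N' := by
        rw [Measure.map_prod_map _ _ measurable_id hm,
          Measure.map_apply (measurable_id.prodMap hm) hN']
        rfl
    _ ≤ ((Measure.pi fun _ => laplace b₁).prod
          (ENNReal.ofReal (Real.exp (|a| / b₂)) • Measure.pi fun _ => laplace b₂)) N' := by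
        rw [Measure.map_id]
        have : SFinite (ENNReal.ofReal (Real.exp (|a| / b₂)) •
          Measure.pi fun _ : Fin T => laplace b₂) := inferInstance
        exact Measure.prod_mono le_rfl (pi_laplace_map_update_le hb₂ t a) N'
    _ = _ := by
        rw [Measure.prod_smul_right]
        rfl

/-- Privacy of all instances of AboveThreshold together. The loss of a round is counted by the
queries of at most one instance, all of them for the same expert, so that these queries increase or
decrease by the same amount. An increase is compensated by increasing the noisy threshold of this
instance, a decrease by increasing the noise of its last query. -/
lemma noiseLaw_consistentNoise_le {b₁ b₂ : ℝ} (hb₁ : 0 < b₁) (hb : b₁ ≤ b₂) {K L : ℝ}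
    {ℓ ℓ' : Losses T d} {i : Fin T} (hℓ : ∀ j, j ≠ i → ℓ j = ℓ' j) (σ : Transcript T d)
    {x₀ : Fin d} (h₀ : initialState T x₀ = σ 0) :
    noiseLaw T b₁ b₂ (consistentNoise K L ℓ σ) ≤
      ENNReal.ofReal (Real.exp (1 / b₁)) * noiseLaw T b₁ b₂ (consistentNoise K L ℓ' σ) := by
  have hb₂ : 0 < b₂ := hb₁.trans_le hb
  rcases (consistentNoise K L ℓ σ).eq_empty_or_nonempty with hemp | ⟨z₀, hz₀⟩
  · simp [hemp]
  have hN' := measurableSet_consistentNoise K L ℓ' σ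
  obtain ⟨ω, -, -, rfl⟩ := exists_run_of_mem_consistentNoise hz₀ h₀
  clear hz₀ h₀ z₀
  set σ := run K L ℓ (x₀, ω)
  have hσ : ∀ t : Fin T, σ t.castSucc = stateAfter K L ℓ x₀ ω t := fun t => rfl
  have hσ' : ∀ t : Fin T, σ t.succ = stateAfter K L ℓ x₀ ω (t + 1) := fun t => by
    simp [σ, run]
  have hle1 : ENNReal.ofReal (Real.exp (0 / b₁)) ≤ ENNReal.ofReal (Real.exp (1 / b₁)) := by
    gcongr; exact zero_le_one
  -- queries that do not count the loss of round `i` are unchanged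
  have hsame : ∀ t : Fin T, ¬((σ t.castSucc).start ≤ i ∧ (i : ℕ) < t) →
      lossBetween ℓ' (σ t.castSucc).start t (σ t.castSucc).expert =
        lossBetween ℓ (σ t.castSucc).start t (σ t.castSucc).expert := by
    intro t ht
    rw [lossBetween_of_neighbor hℓ, if_neg ht, add_zero]
  by_cases hq₀ : ∃ r₀, Querying K (stateAfter K L ℓ x₀ ω (i + 1)) (i + 1) r₀ ∧
      (stateAfter K L ℓ x₀ ω (i + 1)).start ≤ i
  swap
  · -- the loss of round `i` is not counted by any query
    have hun : ∀ (t r : Fin T), Querying K (σ t.castSucc) t r →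
        lossBetween ℓ' (σ t.castSucc).start t (σ t.castSucc).expert =
          lossBetween ℓ (σ t.castSucc).start t (σ t.castSucc).expert := by
      intro t r hq
      refine hsame t fun ⟨h1, h2⟩ => ?_
      rw [hσ] at hq h1
      exact absurd h1 (Querying.lt_start_of_not_querying (by omega) (by omega) hq₀ hq).not_ge
    have hsub : consistentNoise K L ℓ σ ⊆ consistentNoise K L ℓ' σ := fun z hz =>
      mem_consistentNoise_of_same_answers hz
        (fun t r hq _ h => by rwa [hun t r hq]) (fun t r hq _ h => by rwa [hun t r hq])
    calc _ ≤ 1 * noiseLaw T b₁ b₂ (consistentNoise K L ℓ' σ) := by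
          rw [one_mul]; exact measure_mono hsub
      _ ≤ _ := by
          gcongr
          simpa using hle1
  obtain ⟨r₀, hr₀, hstart₀⟩ := hq₀
  set s₀ := stateAfter K L ℓ x₀ ω (i + 1) with hs₀
  set Δ : ℝ := ℓ' i s₀.expert - ℓ i s₀.expert with hΔ
  have hΔ1 : |Δ| ≤ 1 := by
    rw [abs_le]
    have h1 := (ℓ' i s₀.expert).2
    have h2 := (ℓ i s₀.expert).2
    simp only [Set.mem_Icc] at h1 h2
    constructor <;> linarith [h1.1, h1.2, h2.1, h2.2]
  have hr₀i : (r₀ : ℕ) ≤ i + 1 := hr₀.instance_le (by omega)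
  -- a query that counts the loss of round `i` belongs to the instance `r₀`
  have hafter : ∀ t r : Fin T, (i : ℕ) < t → Querying K (σ t.castSucc) t r →
      ((σ t.castSucc).start ≤ i ∧ r = r₀ ∧
        lossBetween ℓ' (σ t.castSucc).start t (σ t.castSucc).expert =
          lossBetween ℓ (σ t.castSucc).start t (σ t.castSucc).expert + Δ) ∨
      (¬(σ t.castSucc).start ≤ i ∧ r ≠ r₀) := by
    intro t r ht hq
    rw [hσ] at hq ⊢
    rcases Querying.same_or_later (m := i + 1) (by omega) (by omega) hr₀ hq with
      ⟨h1, h2, h3⟩ | ⟨h1, h2⟩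
    · refine .inl ⟨by rwa [h1], h3, ?_⟩
      rw [lossBetween_of_neighbor hℓ, if_pos ⟨by rwa [h1], ht⟩, h2]
    · refine .inr ⟨by omega, ?_⟩
      rintro rfl
      omega
  rcases le_total 0 Δ with hpos | hneg
  · refine (noiseLaw_le_of_shift_threshold hb₁ hb₂ r₀ Δ hN' ?_).trans ?_
    · intro z hz
      refine mem_consistentNoise_of_same_answers hz ?_ ?_
      · intro t r hq htrig hle
        rcases lt_or_ge (i : ℕ) t with ht | ht
        · rcases hafter t r ht hq with ⟨-, rfl, h⟩ | ⟨h, hr⟩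
          · simp only [Function.update_self]
            linarith
          · simp only [Function.update_of_ne hr]
            rw [hsame t fun h' => h h'.1]
            exact hle
        · -- an instance that ends in round `i` or before is not running in round `i + 1`
          have hr : r ≠ r₀ := by
            rintro rfl
            rw [hσ] at hq
            rw [hσ'] at htrig
            have h1 := hq.instance_le (by omega)
            rcases ht.eq_or_lt with ht | ht
            · rw [ht, ← hs₀] at htrig
              exact hr₀.phase_ne_triggered htrig
            · have := (lt_instance_of_triggered (m := i + 1) (by omega) (by omega) htrig).2 r hr₀
              omega
          simp only [Function.update_of_ne hr]
          rw [hsame t fun h' => by omega]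
          exact hle
      · intro t r hq _ hlt
        have hupd : z.1 r ≤ Function.update z.1 r₀ (z.1 r₀ + Δ) r := by
          rcases eq_or_ne r r₀ with rfl | hr
          · simpa using hpos
          · simp [Function.update_of_ne hr]
        rcases lt_or_ge (i : ℕ) t with ht | ht
        · rcases hafter t r ht hq with ⟨-, rfl, h⟩ | ⟨h, hr⟩
          · simp only [Function.update_self]
            linarith
          · rw [hsame t fun h' => h h'.1]
            simp only
            linarith
        · rw [hsame t fun h' => by omega]
          simp only
          linarith
    · gcongr
  · by_cases htr : ∃ t r : Fin T, (i : ℕ) < t ∧ (σ t.castSucc).start ≤ i ∧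
        Querying K (σ t.castSucc) t r ∧ (σ t.succ).phase = .triggered
    · obtain ⟨t₀, r₁, ht₀, hst₀, hq₀, htrig₀⟩ := htr
      refine (noiseLaw_le_of_shift_query hb₁ hb₂ t₀ (-Δ) hN' ?_).trans ?_
      · intro z hz
        refine mem_consistentNoise_of_same_answers hz ?_ ?_
        · intro t r hq htrig hle
          have hupd : z.2 t ≤ Function.update z.2 t₀ (z.2 t₀ + -Δ) t := by
            rcases eq_or_ne t t₀ with rfl | hr
            · simpa using hneg
            · simp [Function.update_of_ne hr]
          by_cases hc : (σ t.castSucc).start ≤ i ∧ (i : ℕ) < t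
          · -- at most one query that counts the loss of round `i` is answered positively
            have hne : ∀ {t t' : Fin T} {r' : Fin T}, (i : ℕ) < t →
                (σ t.succ).phase = .triggered → (σ t'.castSucc).start ≤ i →
                Querying K (σ t'.castSucc) t' r' → ¬t < t' := by
              intro t t' r' h1 h2 h3 h4 h5
              rw [hσ] at h3 h4
              rw [hσ'] at h2
              rcases (Nat.succ_le_of_lt h5).eq_or_lt with h6 | h6
              · rw [← h6] at h4
                exact h4.phase_ne_triggered h2
              · have := (lt_instance_of_triggered h6 (by omega) h2).1
                omega
            obtain rfl : t = t₀ := le_antisymm (not_lt.1 (hne ht₀ htrig₀ hc.1 hq))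
              (not_lt.1 (hne hc.2 htrig hst₀ hq₀))
            rcases hafter t r hc.2 hq with ⟨-, rfl, h⟩ | ⟨h, hr⟩
            · simp only [Function.update_self]
              linarith
            · exact absurd hc.1 h
          · rw [hsame t hc]
            simp only
            linarith
        · intro t r hq htrig hlt
          have ht : t ≠ t₀ := by
            rintro rfl
            exact htrig htrig₀
          simp only [Function.update_of_ne ht]
          by_cases hc : (σ t.castSucc).start ≤ i ∧ (i : ℕ) < t
          · rcases hafter t r hc.2 hq with ⟨-, rfl, h⟩ | ⟨h, hr⟩
            · linarith
            · exact absurd hc.1 h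
          · rw [hsame t hc]
            exact hlt
      · rw [abs_neg]
        gcongr
    · have hsub : consistentNoise K L ℓ σ ⊆ consistentNoise K L ℓ' σ := by
        intro z hz
        refine mem_consistentNoise_of_same_answers hz ?_ ?_
        · intro t r hq htrig hle
          rw [hsame t fun h' => htr ⟨t, r, h'.2, h'.1, hq, htrig⟩]
          exact hle
        · intro t r hq htrig hlt
          by_cases hc : (σ t.castSucc).start ≤ i ∧ (i : ℕ) < t
          · rcases hafter t r hc.2 hq with ⟨-, rfl, h⟩ | ⟨h, hr⟩
            · linarith
            · exact absurd hc.1 h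
          · rw [hsame t hc]
            exact hlt
      calc _ ≤ 1 * noiseLaw T b₁ b₂ (consistentNoise K L ℓ' σ) := by
            rw [one_mul]; exact measure_mono hsub
        _ ≤ _ := by
            gcongr
            simpa using hle1

/-! ### The exponential mechanism -/

/-- The unnormalized weights of the exponential mechanism. -/
def weight (η : ℝ) (s : Fin d → ℝ) (x : Fin d) : ℝ := Real.exp (-η * s x / 2)

lemma weight_pos (η : ℝ) (s : Fin d → ℝ) (x : Fin d) : 0 < weight η s x := Real.exp_pos _

lemma sum_weight_pos [NeZero d] (η : ℝ) (s : Fin d → ℝ) : 0 < ∑ x, weight η s x :=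
  Finset.sum_pos (fun x _ => weight_pos η s x) Finset.univ_nonempty

lemma expMech_apply [NeZero d] (η : ℝ) (s : Fin d → ℝ) (x : Fin d) :
    expMech η s x = ENNReal.ofReal (weight η s x / ∑ y, weight η s y) := by
  unfold expMech
  rw [PMF.normalize_apply, tsum_fintype, ← ENNReal.ofReal_sum_of_nonneg fun y _ =>
    (Real.exp_pos _).le, ← div_eq_mul_inv, ENNReal.ofReal_div_of_pos (sum_weight_pos η s)]
  rfl

lemma weight_le_mul_weight {η : ℝ} (hη : 0 ≤ η) {s s' : Fin d → ℝ} {x : Fin d}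
    (h : |s x - s' x| ≤ 1) : weight η s x ≤ Real.exp (η / 2) * weight η s' x := by
  unfold weight
  rw [← Real.exp_add]
  gcongr
  nlinarith [(abs_le.1 h).1]

/-- The exponential mechanism is `η`-differentially private for scores of sensitivity one. -/
lemma expMech_le [NeZero d] {η : ℝ} (hη : 0 ≤ η) {s s' : Fin d → ℝ}
    (h : ∀ x, |s x - s' x| ≤ 1) (x : Fin d) :
    expMech η s x ≤ ENNReal.ofReal (Real.exp η) * expMech η s' x := by
  rw [expMech_apply, expMech_apply, ← ENNReal.ofReal_mul (by positivity)]
  refine ENNReal.ofReal_le_ofReal ?_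
  rw [← mul_div_assoc, div_le_div_iff₀ (sum_weight_pos η s) (sum_weight_pos η s')]
  have h1 := weight_le_mul_weight hη (h x)
  have h2 : ∑ y, weight η s' y ≤ Real.exp (η / 2) * ∑ y, weight η s y := by
    rw [Finset.mul_sum]
    refine Finset.sum_le_sum fun y _ => weight_le_mul_weight hη ?_
    rw [abs_sub_comm]
    exact h y
  calc _ ≤ (Real.exp (η / 2) * weight η s' x) * (Real.exp (η / 2) * ∑ y, weight η s y) :=
        mul_le_mul h1 h2 (sum_weight_pos η s').le (mul_pos (Real.exp_pos _) (weight_pos ..)).le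
    _ = (Real.exp (η / 2) * Real.exp (η / 2)) * weight η s' x * ∑ y, weight η s y := by ring
    _ = _ := by rw [← Real.exp_add, add_halves]

lemma expMech_ne_zero [NeZero d] (η : ℝ) (s : Fin d → ℝ) (x : Fin d) : expMech η s x ≠ 0 := by
  rw [expMech_apply, ← pos_iff_ne_zero, ENNReal.ofReal_pos]
  exact div_pos (weight_pos ..) (sum_weight_pos ..)

/-- The likelihood ratio of two distributions. -/
def ratio (p q : PMF (Fin d)) (x : Fin d) : ℝ := (p x).toReal / (q x).toReal

lemma ratio_pos {p q : PMF (Fin d)} {x : Fin d} (hp : p x ≠ 0) (hq : q x ≠ 0) :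
    0 < ratio p q x :=
  div_pos (ENNReal.toReal_pos hp (p.apply_ne_top x)) (ENNReal.toReal_pos hq (q.apply_ne_top x))

lemma eq_ratio_mul {p q : PMF (Fin d)} {x : Fin d} (hq : q x ≠ 0) :
    p x = ENNReal.ofReal (ratio p q x) * q x := by
  have hq' : 0 < (q x).toReal := ENNReal.toReal_pos hq (q.apply_ne_top x)
  rw [← ENNReal.ofReal_toReal (q.apply_ne_top x),
    ← ENNReal.ofReal_mul (by unfold ratio; positivity), ratio, div_mul_cancel₀ _ hq'.ne',
    ENNReal.ofReal_toReal (p.apply_ne_top x)]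

lemma ratio_le {p q : PMF (Fin d)} {x : Fin d} {η : ℝ} (hq : q x ≠ 0)
    (h : p x ≤ ENNReal.ofReal (Real.exp η) * q x) : ratio p q x ≤ Real.exp η := by
  rw [ratio, div_le_iff₀ (ENNReal.toReal_pos hq (q.apply_ne_top x))]
  have := ENNReal.toReal_mono (ENNReal.mul_ne_top ENNReal.ofReal_ne_top (q.apply_ne_top x)) h
  rwa [ENNReal.toReal_mul, ENNReal.toReal_ofReal (Real.exp_pos _).le] at this

open ProbabilityTheory in
/-- The moments of the likelihood ratio of two distributions that are `η`-close in both directions.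
Hoeffding's lemma bounds them in terms of the mean of the logarithm of the ratio; it also bounds
this mean, because the inverse of the ratio has expectation one. -/
lemma sum_mul_ratio_rpow_le {p q : PMF (Fin d)} (hp : ∀ x, p x ≠ 0) (hq : ∀ x, q x ≠ 0) {η : ℝ}
    (hη : 0 ≤ η) (hpq : ∀ x, p x ≤ ENNReal.ofReal (Real.exp η) * q x)
    (hqp : ∀ x, q x ≤ ENNReal.ofReal (Real.exp η) * p x) {lam : ℝ} (hlam : 0 ≤ lam) :
    ∑ x, (p x).toReal * ratio p q x ^ lam ≤ Real.exp ((lam + lam ^ 2) * η ^ 2 / 2) := by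
  set f : Fin d → ℝ := fun x => Real.log (ratio p q x) with hf
  have hpos := fun x => ratio_pos (hp x) (hq x)
  have hinv : ∀ x, (ratio p q x)⁻¹ = ratio q p x := fun x => by simp [ratio]
  have hfmem : ∀ x, f x ∈ Set.Icc (-η) η := by
    intro x
    constructor
    · rw [neg_le, hf, ← Real.log_inv, hinv, Real.log_le_iff_le_exp (ratio_pos (hq x) (hp x))]
      exact ratio_le (hp x) (hqp x)
    · rw [hf, Real.log_le_iff_le_exp (hpos x)]
      exact ratio_le (hq x) (hpq x)
  have hsub := hasSubgaussianMGF_of_mem_Icc (μ := p.toMeasure) (X := f)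
    (measurable_of_finite f).aemeasurable (ae_of_all _ hfmem)
  set m : ℝ := p.toMeasure[f]
  have hc : (((‖η - -η‖₊ / 2) ^ 2 : NNReal) : ℝ) = η ^ 2 := by
    push_cast
    rw [Real.norm_eq_abs, abs_of_nonneg (by linarith)]
    ring
  have hmgf : ∀ t : ℝ, ∑ x, (p x).toReal * Real.exp (t * (f x - m)) ≤
      Real.exp (η ^ 2 * t ^ 2 / 2) := by
    intro t
    have h := hsub.mgf_le t
    rw [hc, mgf, PMF.integral_eq_sum] at h
    simpa using h
  have hmean : m ≤ η ^ 2 / 2 := by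
    have h := hmgf (-1)
    have h2 : ∑ x, (p x).toReal * Real.exp (-1 * (f x - m)) = Real.exp m := by
      have h3 : ∀ x, (p x).toReal * Real.exp (-1 * (f x - m)) = (q x).toReal * Real.exp m := by
        intro x
        have hp' := ENNReal.toReal_pos (hp x) (p.apply_ne_top x)
        rw [show -1 * (f x - m) = -f x + m by ring, Real.exp_add, hf, ← Real.log_inv,
          hinv, Real.exp_log (ratio_pos (hq x) (hp x)), ratio]
        field_simp
      rw [Finset.sum_congr rfl fun x _ => h3 x, ← Finset.sum_mul,
        ← ENNReal.toReal_sum fun x _ => q.apply_ne_top x,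
        ← tsum_fintype (L := .unconditional _), q.tsum_coe]
      simp
    rw [h2, Real.exp_le_exp] at h
    linarith
  calc ∑ x, (p x).toReal * ratio p q x ^ lam
      = Real.exp (lam * m) * ∑ x, (p x).toReal * Real.exp (lam * (f x - m)) := by
        rw [Finset.mul_sum]
        refine Finset.sum_congr rfl fun x _ => ?_
        rw [mul_left_comm, ← Real.exp_add, Real.rpow_def_of_pos (hpos x)]
        congr 2
        simp only [hf]
        ring
    _ ≤ Real.exp (lam * m) * Real.exp (η ^ 2 * lam ^ 2 / 2) := by
        gcongr
        exact hmgf lam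
    _ ≤ _ := by
        rw [← Real.exp_add, Real.exp_le_exp]
        nlinarith [mul_le_mul_of_nonneg_left hmean hlam]

lemma abs_score_sub_le {ℓ ℓ' : Losses T d} {i : Fin T} (h : ∀ j, j ≠ i → ℓ j = ℓ' j) (Lstar : ℝ)
    (t : ℕ) (x : Fin d) : |score Lstar ℓ t x - score Lstar ℓ' t x| ≤ 1 := by
  unfold score
  refine (abs_max_sub_max_le_abs _ _ _).trans ?_
  rw [lossBetween_of_neighbor h, abs_le]
  have h1 := (ℓ' i x).2
  have h2 := (ℓ i x).2
  simp only [Set.mem_Icc] at h1 h2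
  split_ifs <;> constructor <;> linarith [h1.1, h1.2, h2.1, h2.2]

/-! ### The number of switches -/

/-- The rounds before round `n` in which a new expert is sampled. -/
def switchRoundsBefore (σ : Transcript T d) (n : ℕ) : Finset (Fin T) :=
  {t ∈ switchRounds σ | (t : ℕ) < n}

lemma switchRoundsBefore_zero (σ : Transcript T d) : switchRoundsBefore σ 0 = ∅ := by
  simp [switchRoundsBefore]

lemma switchRoundsBefore_last (σ : Transcript T d) : switchRoundsBefore σ T = switchRounds σ := by
  simp [switchRoundsBefore]

lemma notMem_switchRoundsBefore (σ : Transcript T d) (t : Fin T) :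
    t ∉ switchRoundsBefore σ t := by
  simp [switchRoundsBefore]

lemma switchRoundsBefore_succ_of_triggered {σ : Transcript T d} {t : Fin T}
    (h : (σ t.castSucc).phase = .triggered) :
    switchRoundsBefore σ (t + 1) = insert t (switchRoundsBefore σ t) := by
  ext u
  simp only [switchRoundsBefore, Finset.mem_filter, Finset.mem_insert, mem_switchRounds]
  constructor
  · rintro ⟨h1, h2⟩
    rcases (Nat.lt_succ_iff.1 h2).eq_or_lt with h3 | h3
    · exact .inl (Fin.ext h3)
    · exact .inr ⟨h1, h3⟩
  · rintro (rfl | ⟨h1, h2⟩)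
    · exact ⟨h, Nat.lt_succ_self _⟩
    · exact ⟨h1, by omega⟩

lemma switchRoundsBefore_succ_of_ne {σ : Transcript T d} {t : Fin T}
    (h : (σ t.castSucc).phase ≠ .triggered) :
    switchRoundsBefore σ (t + 1) = switchRoundsBefore σ t := by
  ext u
  simp only [switchRoundsBefore, Finset.mem_filter, mem_switchRounds, and_congr_right_iff]
  intro hu
  have : u ≠ t := by rintro rfl; exact h hu
  have : (u : ℕ) ≠ t := fun h => this (Fin.ext h)
  omega

lemma run_castSucc (K L : ℝ) (ℓ : Losses T d) (x₀ : Fin d) (ω : Fin T → Seed d) (t : Fin T) :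
    run K L ℓ (x₀, ω) t.castSucc = stateAfter K L ℓ x₀ ω t := rfl

lemma run_succ (K L : ℝ) (ℓ : Losses T d) (x₀ : Fin d) (ω : Fin T → Seed d) (t : Fin T) :
    run K L ℓ (x₀, ω) t.succ = stateAfter K L ℓ x₀ ω (t + 1) := by
  simp [run]

lemma card_switchRoundsBefore (K L : ℝ) (ℓ : Losses T d) (x₀ : Fin d) (ω : Fin T → Seed d) {n : ℕ}
    (hn : n ≤ T) :
    (switchRoundsBefore (run K L ℓ (x₀, ω)) n).card = (stateAfter K L ℓ x₀ ω n).switches := by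
  refine stateAfter_induction (P := fun n s =>
    (switchRoundsBefore (run K L ℓ (x₀, ω)) n).card = s.switches) 0 ?_ ?_ ?_ ?_ ?_ n n.zero_le hn
  · simp [switchRoundsBefore_zero, stateAfter]
  · rintro t s - hs hP h
    rw [hs, ← run_castSucc] at h
    rw [switchRoundsBefore_succ_of_triggered h,
      Finset.card_insert_of_notMem (notMem_switchRoundsBefore _ t), hP]
  · rintro t r s - hs hP hq -
    have h := hq.phase_ne_triggered
    rw [hs, ← run_castSucc] at h
    rw [switchRoundsBefore_succ_of_ne h, hP]
  · rintro t r s - hs hP hq -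
    have h := hq.phase_ne_triggered
    rw [hs, ← run_castSucc] at h
    rw [switchRoundsBefore_succ_of_ne h, hP]
  · rintro t s - hs hP hq
    have h : s.phase ≠ .triggered := by simp [hq.1]
    rw [hs, ← run_castSucc] at h
    rw [switchRoundsBefore_succ_of_ne h, hP]

lemma switches_lt {K : ℝ} (hK : 0 ≤ K) (L : ℝ) (ℓ : Losses T d) (x₀ : Fin d)
    (ω : Fin T → Seed d) {n : ℕ} (hn : n ≤ T) :
    ((stateAfter K L ℓ x₀ ω n).switches : ℝ) < K + 1 ∧
      ((stateAfter K L ℓ x₀ ω n).phase ≠ .idle → ((stateAfter K L ℓ x₀ ω n).switches : ℝ) < K) := by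
  have hlt : ∀ (s : State T d) (t : ℕ) (r : Fin T), (s.phase ≠ .idle → (s.switches : ℝ) < K) →
      Querying K s t r → (s.switches : ℝ) < K := by
    rintro s t r hP (hq | hq)
    · exact hP (by simp [hq])
    · exact hq.2.1
  refine stateAfter_induction (P := fun n s => (s.switches : ℝ) < K + 1 ∧
    (s.phase ≠ .idle → (s.switches : ℝ) < K)) 0 ?_ ?_ ?_ ?_ ?_ n n.zero_le hn
  · simp [stateAfter]
    linarith
  · rintro t s - - hP h
    have := hP.2 (by simp [h])
    simpa using this
  · rintro t r s - - hP hq -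
    exact ⟨hP.1, fun _ => hlt s t r hP.2 hq⟩
  · rintro t r s - - hP hq -
    exact ⟨hP.1, fun _ => hlt s t r hP.2 hq⟩
  · rintro t s - - hP hq
    exact hP

lemma card_switchRounds_run_le {K : ℝ} (hK : 0 ≤ K) (L : ℝ) (ℓ : Losses T d)
    (p : Fin d × (Fin T → Seed d)) : ((switchRounds (run K L ℓ p)).card : ℝ) ≤ K + 1 := by
  obtain ⟨x₀, ω⟩ := p
  rw [← switchRoundsBefore_last, card_switchRoundsBefore K L ℓ x₀ ω le_rfl]
  exact (switches_lt hK L ℓ x₀ ω le_rfl).1.le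

/-! ### Privacy of the algorithm -/

lemma ae_exists_run [NeZero d] (K L : ℝ) (ℓ : Losses T d) (b₁ b₂ : ℝ) (p : Fin T → PMF (Fin d)) :
    ∀ᵐ σ ∂transcriptLaw K L ℓ b₁ b₂ p, ∃ q, run K L ℓ q = σ := by
  unfold transcriptLaw
  rw [ae_map_iff (measurable_run K L ℓ).aemeasurable (Set.to_countable _).measurableSet]
  exact ae_of_all _ fun q => ⟨q, rfl⟩

/-- The likelihood ratio of the transcripts for neighbouring loss sequences is at most the
contribution of AboveThreshold times the likelihood ratios of the sampled experts. -/
lemma transcriptLaw_singleton_le [NeZero d] {K L b₁ b₂ : ℝ} (hb₁ : 0 < b₁) (hb : b₁ ≤ b₂)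
    {ℓ ℓ' : Losses T d} {i : Fin T} (hℓ : ∀ j, j ≠ i → ℓ j = ℓ' j)
    {p p' : Fin T → PMF (Fin d)} (hp' : ∀ t x, p' t x ≠ 0) (σ : Transcript T d) :
    transcriptLaw K L ℓ b₁ b₂ p {σ} ≤
      ENNReal.ofReal (Real.exp (1 / b₁)) *
        (∏ t ∈ switchRounds σ, ENNReal.ofReal (ratio (p t) (p' t) (σ t.succ).expert)) *
        transcriptLaw K L ℓ' b₁ b₂ p' {σ} := by
  have hb₂ := hb₁.trans_le hb
  rw [transcriptLaw_singleton K L ℓ hb₁ hb₂, transcriptLaw_singleton K L ℓ' hb₁ hb₂]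
  rcases Set.eq_empty_or_nonempty {x₀ | initialState T x₀ = σ 0} with h | ⟨x₀, h₀⟩
  · simp [h]
  · have hprod : ∏ t ∈ switchRounds σ, p t (σ t.succ).expert =
        (∏ t ∈ switchRounds σ, ENNReal.ofReal (ratio (p t) (p' t) (σ t.succ).expert)) *
          ∏ t ∈ switchRounds σ, p' t (σ t.succ).expert := by
      rw [← Finset.prod_mul_distrib]
      exact Finset.prod_congr rfl fun t _ => eq_ratio_mul (hp' t _)
    calc _ ≤ (PMF.uniformOfFintype (Fin d)).toMeasure {x₀ | initialState T x₀ = σ 0} *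
          (ENNReal.ofReal (Real.exp (1 / b₁)) * noiseLaw T b₁ b₂ (consistentNoise K L ℓ' σ)) *
          ∏ t ∈ switchRounds σ, p t (σ t.succ).expert := by
          gcongr
          exact noiseLaw_consistentNoise_le hb₁ hb hℓ σ h₀
      _ = _ := by
          rw [hprod]
          ring

/-- Outside the event that the likelihood ratio of the sampled experts exceeds `exp a`, the
transcripts for neighbouring loss sequences are pointwise close. -/
lemma transcriptLaw_le_add [NeZero d] {K L b₁ b₂ : ℝ} (hb₁ : 0 < b₁) (hb : b₁ ≤ b₂)
    {ℓ ℓ' : Losses T d} {i : Fin T} (hℓ : ∀ j, j ≠ i → ℓ j = ℓ' j)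
    {p p' : Fin T → PMF (Fin d)} (hp' : ∀ t x, p' t x ≠ 0) (a : ℝ) (S : Set (Transcript T d)) :
    transcriptLaw K L ℓ b₁ b₂ p S ≤
      ENNReal.ofReal (Real.exp (1 / b₁ + a)) * transcriptLaw K L ℓ' b₁ b₂ p' S +
      transcriptLaw K L ℓ b₁ b₂ p {σ | Real.exp a <
        ∏ t ∈ switchRounds σ, ratio (p t) (p' t) (σ t.succ).expert} := by
  set G : Set (Transcript T d) := {σ | Real.exp a <
        ∏ t ∈ switchRounds σ, ratio (p t) (p' t) (σ t.succ).expert} with hG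
  have hm : ∀ A : Set (Transcript T d), MeasurableSet A := fun A =>
    (Set.to_countable A).measurableSet
  have hr : ∀ t x, 0 ≤ ratio (p t) (p' t) x := fun t x => by unfold ratio; positivity
  calc _ ≤ transcriptLaw K L ℓ b₁ b₂ p (S \ G) + transcriptLaw K L ℓ b₁ b₂ p G :=
        (measure_mono (by simp)).trans (measure_union_le (S \ G) G)
    _ ≤ _ := by
        gcongr
        rw [← Measure.tsum_indicator_apply_singleton _ _ (hm _),
          ← Measure.tsum_indicator_apply_singleton _ _ (hm S), ← ENNReal.tsum_mul_left]
        refine ENNReal.tsum_le_tsum fun σ => ?_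
        by_cases hσ : σ ∈ S \ G
        · rw [Set.indicator_of_mem hσ, Set.indicator_of_mem hσ.1]
          refine (transcriptLaw_singleton_le hb₁ hb hℓ hp' σ).trans ?_
          gcongr
          rw [← ENNReal.ofReal_prod_of_nonneg fun t _ => hr _ _, ← ENNReal.ofReal_mul
            (Real.exp_pos _).le, Real.exp_add]
          gcongr
          exact not_lt.1 hσ.2
        · rw [Set.indicator_of_notMem hσ]
          exact zero_le

/-- Almost surely, at most `K + 1` experts are sampled, each with likelihood ratio at most
`exp η`. -/
lemma measure_lt_prod_ratio_eq_zero [NeZero d] {K L b₁ b₂ : ℝ} (hK : 0 ≤ K) {ℓ : Losses T d}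
    {p p' : Fin T → PMF (Fin d)} {η : ℝ} (hη : 0 ≤ η) (hp' : ∀ t x, p' t x ≠ 0)
    (hpp' : ∀ t x, p t x ≤ ENNReal.ofReal (Real.exp η) * p' t x) :
    transcriptLaw K L ℓ b₁ b₂ p {σ | Real.exp ((K + 1) * η) <
        ∏ t ∈ switchRounds σ, ratio (p t) (p' t) (σ t.succ).expert} = 0 := by
  have hr : ∀ t x, 0 ≤ ratio (p t) (p' t) x := fun t x => by unfold ratio; positivity
  refine measure_eq_zero_iff_ae_notMem.2 ?_
  filter_upwards [ae_exists_run K L ℓ b₁ b₂ p] with σ ⟨q, hq⟩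
  refine not_lt.2 ((Finset.prod_le_prod (fun t _ => hr t _) fun t _ =>
    ratio_le (hp' t _) (hpp' t _)).trans ?_)
  rw [Finset.prod_const, ← Real.exp_nat_mul, ← hq]
  gcongr
  exact card_switchRounds_run_le hK L ℓ q

/-- The concentration behind advanced composition, by Markov's inequality for a power of the
likelihood ratio. -/
lemma measure_lt_prod_ratio_le [NeZero d] {K L b₁ b₂ : ℝ} (hb₁ : 0 < b₁) (hb₂ : 0 < b₂)
    (hK : 0 ≤ K) {ℓ : Losses T d}
    {p p' : Fin T → PMF (Fin d)} {η : ℝ} (hη : 0 ≤ η) (hp : ∀ t x, p t x ≠ 0)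
    (hp' : ∀ t x, p' t x ≠ 0)
    (hpp' : ∀ t x, p t x ≤ ENNReal.ofReal (Real.exp η) * p' t x)
    (hp'p : ∀ t x, p' t x ≤ ENNReal.ofReal (Real.exp η) * p t x) {lam : ℝ} (hlam : 0 ≤ lam)
    (a : ℝ) :
    transcriptLaw K L ℓ b₁ b₂ p {σ | Real.exp a <
        ∏ t ∈ switchRounds σ, ratio (p t) (p' t) (σ t.succ).expert} ≤
      ENNReal.ofReal (Real.exp ((K + 1) * ((lam + lam ^ 2) * η ^ 2 / 2) - lam * a)) := by
  have hr : ∀ t x, 0 < ratio (p t) (p' t) x := fun t x => ratio_pos (hp t x) (hp' t x)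
  set ψ : ℝ := (lam + lam ^ 2) * η ^ 2 / 2 with hψ
  have hψ0 : 0 ≤ ψ := by positivity
  set g : Fin T → Fin d → ENNReal :=
    fun t x => ENNReal.ofReal (ratio (p t) (p' t) x ^ lam * Real.exp (-ψ)) with hg
  have hg1 : ∀ t, ∑ x, p t x * g t x ≤ 1 := by
    intro t
    have h : ∀ x, p t x * g t x = ENNReal.ofReal
        ((p t x).toReal * ratio (p t) (p' t) x ^ lam * Real.exp (-ψ)) := by
      intro x
      rw [hg, mul_assoc, ENNReal.ofReal_mul ENNReal.toReal_nonneg,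
        ENNReal.ofReal_toReal ((p t).apply_ne_top x)]
    rw [Finset.sum_congr rfl fun x _ => h x, ← ENNReal.ofReal_sum_of_nonneg fun x _ => by
      have := (hr t x).le
      positivity, ← Finset.sum_mul, ENNReal.ofReal_le_one]
    calc _ ≤ Real.exp ψ * Real.exp (-ψ) := by
          gcongr
          exact sum_mul_ratio_rpow_le (hp t) (hp' t) hη (hpp' t) (hp'p t) hlam
      _ = 1 := by rw [← Real.exp_add]; simp
  set θ : ℝ := lam * a - (K + 1) * ψ with hθ
  have hmarkov := (mul_meas_ge_le_lintegral₀ (μ := transcriptLaw K L ℓ b₁ b₂ p)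
    (f := fun σ => ∏ t ∈ switchRounds σ, g t (σ t.succ).expert)
    (Measurable.of_discrete).aemeasurable (ENNReal.ofReal (Real.exp θ))).trans
    (lintegral_prod_switchRounds_le_one K L ℓ hb₁ hb₂ p g hg1)
  have hsub : transcriptLaw K L ℓ b₁ b₂ p {σ | Real.exp a <
        ∏ t ∈ switchRounds σ, ratio (p t) (p' t) (σ t.succ).expert} ≤
      transcriptLaw K L ℓ b₁ b₂ p {σ | ENNReal.ofReal (Real.exp θ) ≤
        ∏ t ∈ switchRounds σ, g t (σ t.succ).expert} := by
    refine measure_mono_ae ?_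
    filter_upwards [ae_exists_run K L ℓ b₁ b₂ p] with σ ⟨q, hq⟩ hσ
    change Real.exp a < _ at hσ
    change ENNReal.ofReal (Real.exp θ) ≤ _
    have hcard := card_switchRounds_run_le hK L ℓ q
    rw [hq] at hcard
    rw [hg, ← ENNReal.ofReal_prod_of_nonneg fun t _ => by
      have := (hr t (σ t.succ).expert).le
      positivity]
    refine ENNReal.ofReal_le_ofReal ?_
    rw [Finset.prod_mul_distrib, Real.finsetProd_rpow _ _ fun t _ => (hr t _).le,
      Finset.prod_const, ← Real.exp_nat_mul]
    calc Real.exp θ = Real.exp a ^ lam * Real.exp ((K + 1) * -ψ) := by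
          rw [← Real.exp_mul, ← Real.exp_add, hθ]
          ring_nf
      _ ≤ _ := by
          have h1 : Real.exp a ^ lam ≤
              (∏ t ∈ switchRounds σ, ratio (p t) (p' t) (σ t.succ).expert) ^ lam :=
            Real.rpow_le_rpow (Real.exp_pos _).le hσ.le hlam
          have h2 : (K + 1) * -ψ ≤ (switchRounds σ).card * -ψ := by nlinarith
          gcongr
          exact Real.rpow_nonneg (Finset.prod_nonneg fun t _ => (hr t _).le) _
  refine hsub.trans ?_
  rw [show (K + 1) * ψ - lam * a = -θ by rw [hθ]; ring, Real.exp_neg,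
    ENNReal.ofReal_inv_of_pos (Real.exp_pos θ), ENNReal.le_inv_iff_mul_le, mul_comm]
  exact hmarkov

lemma measurable_plays (K L : ℝ) (ℓ : Losses T d) : Measurable (plays K L ℓ) :=
  (Measurable.of_discrete (f := fun (σ : Transcript T d) (t : Fin T) => (σ t.succ).expert)).comp
    (measurable_run K L ℓ)

lemma sparseVectorExperts_apply [NeZero d] (K Lstar η L ε : ℝ) (ℓ : Losses T d)
    (S : Set (Fin T → Fin d)) :
    sparseVectorExperts K Lstar η L ε ℓ S =
      transcriptLaw K L ℓ (2 / (ε / 2)) (4 / (ε / 2)) (fun t => expMech η (score Lstar ℓ t))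
        {σ | (fun t : Fin T => (σ t.succ).expert) ∈ S} := by
  unfold sparseVectorExperts transcriptLaw
  rw [Measure.map_apply (measurable_plays K L ℓ) (Set.to_countable S).measurableSet,
    Measure.map_apply (measurable_run K L ℓ) (Set.to_countable _).measurableSet]
  congr 1

/-- Pure privacy: AboveThreshold contributes at most `ε / 4`, the exponential mechanism at most `η`
in each of at most `K + 1` rounds. -/
lemma isDP_pure [NeZero d] {K L Lstar ε η : ℝ} (hK : 2 ≤ K) (hε : 0 < ε) (hη : η = ε / (2 * K)) :
    IsDP (fun ℓ : Losses T d => sparseVectorExperts K Lstar η L ε ℓ) ε 0 := by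
  rintro ℓ ℓ' ⟨i, hℓ⟩ S -
  have hη0 : 0 ≤ η := by rw [hη]; positivity
  have hb₁ : 0 < 2 / (ε / 2) := by positivity
  have hb : 2 / (ε / 2) ≤ 4 / (ε / 2) := by gcongr; norm_num
  simp only [sparseVectorExperts_apply]
  refine (transcriptLaw_le_add (p' := fun t => expMech η (score Lstar ℓ' t)) hb₁ hb hℓ
    (fun t x => expMech_ne_zero _ _ _) ((K + 1) * η) _).trans ?_
  rw [measure_lt_prod_ratio_eq_zero (by linarith) hη0 (fun t x => expMech_ne_zero _ _ _)
    (fun t x => expMech_le hη0 (fun y => abs_score_sub_le hℓ Lstar t y) x), ENNReal.ofReal_zero]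
  gcongr
  have h1 : 1 / (2 / (ε / 2)) = ε / 4 := by field_simp; norm_num
  have h2 : (K + 1) * η ≤ 3 / 4 * ε := by
    rw [hη, mul_div_assoc', div_le_iff₀ (by linarith)]
    nlinarith
  linarith

/-- Approximate privacy: AboveThreshold contributes at most `ε / 4`, and the exponential mechanism
contributes at most `3 ε / 4` except with probability `δ`. -/
lemma isDP_approx [NeZero d] {K L Lstar ε δ η : ℝ} (hK : 1 ≤ K) (hε : 0 < ε) (hδ : 0 < δ)
    (hεδ : ε ≤ Real.log (1 / δ))
    (hη : η = ε / (4 * √(2 * K * Real.log (1 / δ)))) :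
    IsDP (fun ℓ : Losses T d => sparseVectorExperts K Lstar η L ε ℓ) ε δ := by
  rintro ℓ ℓ' ⟨i, hℓ⟩ S -
  have hℓ' : ∀ j, j ≠ i → ℓ' j = ℓ j := fun j hj => (hℓ j hj).symm
  have hη0 : 0 ≤ η := by rw [hη]; positivity
  have hb₁ : 0 < 2 / (ε / 2) := by positivity
  have hb : 2 / (ε / 2) ≤ 4 / (ε / 2) := by gcongr; norm_num
  set l := Real.log (1 / δ) with hl
  have hl0 : 0 < l := hε.trans_le hεδ
  simp only [sparseVectorExperts_apply]
  refine (transcriptLaw_le_add (p' := fun t => expMech η (score Lstar ℓ' t)) hb₁ hb hℓ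
    (fun t x => expMech_ne_zero _ _ _) (3 / 4 * ε) _).trans ?_
  have h1 : 1 / (2 / (ε / 2)) + 3 / 4 * ε = ε := by field_simp; norm_num
  rw [h1]
  gcongr
  -- the power `2 l / ε` is, up to a constant, the best choice in Markov's inequality
  refine (measure_lt_prod_ratio_le hb₁ (hb₁.trans_le hb) (by linarith) hη0
    (fun t x => expMech_ne_zero _ _ _) (fun t x => expMech_ne_zero _ _ _)
    (fun t x => expMech_le hη0 (fun y => abs_score_sub_le hℓ Lstar t y) x)
    (fun t x => expMech_le hη0 (fun y => abs_score_sub_le hℓ' Lstar t y) x)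
    (lam := 2 * l / ε) (by positivity) _).trans ?_
  refine ENNReal.ofReal_le_ofReal ?_
  have hδl : δ = Real.exp (-l) := by
    rw [hl, one_div, Real.log_inv, neg_neg, Real.exp_log hδ]
  rw [hδl, Real.exp_le_exp]
  have hη2 : η ^ 2 = ε ^ 2 / (32 * K * l) := by
    rw [hη, div_pow, mul_pow, Real.sq_sqrt (by positivity)]
    ring
  have h2 : (2 * l / ε + (2 * l / ε) ^ 2) * η ^ 2 / 2 = (ε + 2 * l) / (32 * K) := by
    rw [hη2]
    field_simp
  have h3 : 2 * l / ε * (3 / 4 * ε) = 3 / 2 * l := by field_simp; norm_num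
  rw [h2, h3, mul_div_assoc']
  have h4 : (K + 1) * (ε + 2 * l) / (32 * K) ≤ l / 2 := by
    rw [div_le_iff₀ (by linarith)]
    nlinarith [mul_nonneg (sub_nonneg.2 hK) hl0.le,
      mul_nonneg (sub_nonneg.2 hεδ) (by linarith : 0 ≤ K + 1)]
  linarith

/-! ### Cumulative losses -/

lemma lossBetween_self (ℓ : Losses T d) (s : ℕ) (x : Fin d) : lossBetween ℓ s s x = 0 := by
  unfold lossBetween
  rw [Finset.filter_false_of_mem fun i _ => by omega, Finset.sum_empty]

lemma lossBetween_mono_right (ℓ : Losses T d) (s : ℕ) {m n : ℕ} (h : m ≤ n) (x : Fin d) :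
    lossBetween ℓ s m x ≤ lossBetween ℓ s n x := by
  refine Finset.sum_le_sum_of_subset_of_nonneg (fun i hi => ?_) fun i _ _ => (ℓ i x).2.1
  simp only [Finset.mem_filter, Finset.mem_univ, true_and] at hi ⊢
  omega

lemma lossBetween_nonneg (ℓ : Losses T d) (s n : ℕ) (x : Fin d) : 0 ≤ lossBetween ℓ s n x :=
  Finset.sum_nonneg fun i _ => (ℓ i x).2.1

lemma lossBetween_succ (ℓ : Losses T d) {s : ℕ} {t : Fin T} (h : s ≤ t) (x : Fin d) :
    lossBetween ℓ s (t + 1) x = lossBetween ℓ s t x + ℓ t x := by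
  unfold lossBetween
  have : (Finset.univ.filter fun i : Fin T => s ≤ i.val ∧ i.val < t + 1) =
      insert t (Finset.univ.filter fun i : Fin T => s ≤ i.val ∧ i.val < t) := by
    ext i
    simp only [Finset.mem_filter, Finset.mem_univ, true_and, Finset.mem_insert, Fin.ext_iff]
    omega
  rw [this, Finset.sum_insert (by simp), add_comm]

lemma lossBetween_add (ℓ : Losses T d) {s t : ℕ} (h : s ≤ t) (x : Fin d) :
    lossBetween ℓ 0 s x + lossBetween ℓ s t x = lossBetween ℓ 0 t x := by
  unfold lossBetween
  rw [← Finset.sum_union]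
  · congr 1
    ext i
    simp only [Finset.mem_filter, Finset.mem_univ, true_and, Finset.mem_union]
    omega
  · refine Finset.disjoint_left.2 fun i h1 h2 => ?_
    simp only [Finset.mem_filter, Finset.mem_univ, true_and] at h1 h2
    omega

lemma lossBetween_le_total (ℓ : Losses T d) (s n : ℕ) (x : Fin d) :
    lossBetween ℓ s n x ≤ ∑ t, (ℓ t x : ℝ) :=
  Finset.sum_le_sum_of_subset_of_nonneg (Finset.subset_univ _) fun i _ _ => (ℓ i x).2.1

/-! ### The loss of the algorithm in terms of the number of switches -/

section

variable {K L z : ℝ} {ℓ : Losses T d} {x₀ : Fin d} {ω : Fin T → Seed d}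

lemma expert_succ_of_triggered {t : Fin T}
    (h : (stateAfter K L ℓ x₀ ω t).phase = .triggered) :
    (stateAfter K L ℓ x₀ ω (t + 1)).expert = (ω t).2.2 := by
  rw [stateAfter_succ, step_of_triggered h]

lemma expert_succ_of_ne {t : Fin T} (h : (stateAfter K L ℓ x₀ ω t).phase ≠ .triggered) :
    (stateAfter K L ℓ x₀ ω (t + 1)).expert = (stateAfter K L ℓ x₀ ω t).expert := by
  rw [stateAfter_succ]
  rcases triggered_or_querying_or_stopped K (stateAfter K L ℓ x₀ ω t) t with h' | ⟨r, h'⟩ | h'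
  · exact absurd h' h
  · rw [h'.step_eq]
    rfl
  · rw [step_of_stopped h']

/-- If the noise of every query and that of every threshold differ by less than `z`, then each
expert suffers a loss of at most `L + z + 2` before it is replaced. -/
lemma totalLoss_plays_le (hz : ∀ r t, |(ω t).2.1 - (ω r).1| < z) (hM : 0 ≤ L + z)
    (hK : ((stateAfter K L ℓ x₀ ω T).switches : ℝ) < K) :
    totalLoss ℓ (plays K L ℓ (x₀, ω)) ≤ (K + 1) * (L + z + 2) := by
  set total : ℕ → ℝ := fun n => ∑ t : Fin T with t.val < n, (ℓ t (plays K L ℓ (x₀, ω) t) : ℝ)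
    with htotal
  have hsucc : ∀ t : Fin T, total (t + 1) =
      total t + ℓ t (stateAfter K L ℓ x₀ ω (t + 1)).expert := by
    intro t
    have : (Finset.univ.filter fun i : Fin T => i.val < t + 1) =
        insert t (Finset.univ.filter fun i : Fin T => i.val < t) := by
      ext i
      simp only [Finset.mem_filter, Finset.mem_univ, true_and, Finset.mem_insert, Fin.ext_iff]
      omega
    simp only [htotal]
    rw [this, Finset.sum_insert (by simp), add_comm]
    rfl
  have key : (stateAfter K L ℓ x₀ ω T).start ≤ T ∧
      total T ≤ (stateAfter K L ℓ x₀ ω T).switches * (L + z + 2) + lossBetween ℓ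
        (stateAfter K L ℓ x₀ ω T).start T (stateAfter K L ℓ x₀ ω T).expert ∧
      (((stateAfter K L ℓ x₀ ω T).switches : ℝ) < K → lossBetween ℓ
        (stateAfter K L ℓ x₀ ω T).start T (stateAfter K L ℓ x₀ ω T).expert ≤ L + z + 2) ∧
      (((stateAfter K L ℓ x₀ ω T).switches : ℝ) < K →
        (stateAfter K L ℓ x₀ ω T).phase ≠ .triggered → lossBetween ℓ
        (stateAfter K L ℓ x₀ ω T).start T (stateAfter K L ℓ x₀ ω T).expert ≤ L + z + 1) := by
    refine stateAfter_induction (P := fun n s => s.start ≤ n ∧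
      total n ≤ s.switches * (L + z + 2) + lossBetween ℓ s.start n s.expert ∧
      ((s.switches : ℝ) < K → lossBetween ℓ s.start n s.expert ≤ L + z + 2) ∧
      ((s.switches : ℝ) < K → s.phase ≠ .triggered →
        lossBetween ℓ s.start n s.expert ≤ L + z + 1)) 0 ?_ ?_ ?_ ?_ ?_ T T.zero_le le_rfl
    · simp [stateAfter, htotal, lossBetween_self]
      constructor <;> intro <;> linarith
    · rintro t s - hs ⟨h1, h2, h3, -⟩ h
      have hk : (s.switches : ℝ) < K := by
        have := (switches_lt (hK := (Nat.cast_nonneg _).trans hK.le) L ℓ x₀ ω t.2.le).2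
        rw [← hs] at this
        exact this (by simp [h])
      have h3 := h3 hk
      rw [hs] at h
      have hℓ := (ℓ t (ω t).2.2).2.2
      rw [hsucc, expert_succ_of_triggered h]
      simp only
      rw [lossBetween_succ ℓ le_rfl, lossBetween_self]
      push_cast
      refine ⟨by omega, by linarith, fun _ => by linarith, fun _ _ => by linarith⟩
    · rintro t r s - hs ⟨h1, h2, -, h4⟩ hq -
      have hne := hq.phase_ne_triggered
      have hexp := expert_succ_of_ne (hs ▸ hne)
      rw [← hs] at hexp
      have hℓ := (ℓ t s.expert).2.2
      rw [hsucc, hexp]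
      simp only
      rw [lossBetween_succ ℓ h1]
      exact ⟨by omega, by linarith, fun hk => by linarith [h4 hk hne], fun _ h => absurd rfl h⟩
    · rintro t r s - hs ⟨h1, h2, -, -⟩ hq hlt
      have hne := hq.phase_ne_triggered
      have hexp := expert_succ_of_ne (hs ▸ hne)
      rw [← hs] at hexp
      have hℓ := (ℓ t s.expert).2.2
      have hn := (abs_lt.1 (hz r t)).1
      rw [hsucc, hexp]
      simp only
      rw [lossBetween_succ ℓ h1]
      exact ⟨by omega, by linarith, fun _ => by linarith, fun _ _ => by linarith⟩
    · rintro t s - hs ⟨h1, h2, -, -⟩ hst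
      have hne : s.phase ≠ .triggered := by simp [hst.1]
      have hexp := expert_succ_of_ne (hs ▸ hne)
      rw [← hs] at hexp
      rw [hsucc, hexp, lossBetween_succ ℓ h1]
      exact ⟨by omega, by linarith, fun h => absurd h hst.2, fun h => absurd h hst.2⟩
  have htot : totalLoss ℓ (plays K L ℓ (x₀, ω)) = total T := by
    simp [totalLoss, htotal]
  rw [htot]
  nlinarith [key.2.1, key.2.2.1 hK]

end

/-! ### The number of switches is small -/

/-- The total weight of all experts in the exponential mechanism of round `t`. -/
def totalWeight (η Lstar : ℝ) (ℓ : Losses T d) (t : ℕ) : ℝ := ∑ x, weight η (score Lstar ℓ t) x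

/-- The experts whose loss from round `s` on exceeds `Θ` no later than that of `x`. -/
def noLaterThan (Θ : ℝ) (ℓ : Losses T d) (s : ℕ) (x : Fin d) : Finset (Fin d) :=
  open Classical in {y | ∀ n, Θ < lossBetween ℓ s n x → Θ < lossBetween ℓ s n y}

/-- An upper bound for the factor by which the total weight decreases from round `s` to the time
when the loss of `x` since round `s` exceeds the threshold `Lstar + 4 / η`: by then each expert
`y` in `noLaterThan` has lost a factor of `exp (-2)`. -/
def decay (η Lstar : ℝ) (ℓ : Losses T d) (s : ℕ) (x : Fin d) : ℝ :=
  1 - (1 - Real.exp (-2)) *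
    ((∑ y ∈ noLaterThan (Lstar + 4 / η) ℓ s x, weight η (score Lstar ℓ s) y) /
      totalWeight η Lstar ℓ s)

section

variable {η Lstar : ℝ} {ℓ : Losses T d}

lemma totalWeight_pos [NeZero d] (η Lstar : ℝ) (ℓ : Losses T d) (t : ℕ) :
    0 < totalWeight η Lstar ℓ t := sum_weight_pos _ _

lemma weight_score_anti (hη : 0 ≤ η) (Lstar : ℝ) (ℓ : Losses T d) {s t : ℕ} (h : s ≤ t)
    (x : Fin d) : weight η (score Lstar ℓ t) x ≤ weight η (score Lstar ℓ s) x := by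
  unfold weight score
  have h1 := max_le_max_right Lstar (lossBetween_mono_right ℓ 0 h x)
  have h2 := mul_le_mul_of_nonneg_left h1 hη
  rw [Real.exp_le_exp]
  linarith

lemma exp_neg_two_le_decay [NeZero d] (s : ℕ) (x : Fin d) :
    Real.exp (-2) ≤ decay η Lstar ℓ s x := by
  unfold decay
  have h1 : (∑ y ∈ noLaterThan (Lstar + 4 / η) ℓ s x, weight η (score Lstar ℓ s) y) /
      totalWeight η Lstar ℓ s ≤ 1 := by
    rw [div_le_one (totalWeight_pos ..)]
    exact Finset.sum_le_sum_of_subset_of_nonneg (Finset.subset_univ _)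
      fun y _ _ => (weight_pos ..).le
  have h2 : Real.exp (-2) ≤ 1 := Real.exp_le_one_iff.2 (by norm_num)
  nlinarith

lemma weight_le_of_lt_lossBetween (hη : 0 < η) {s n : ℕ} (hsn : s ≤ n) (hL : 0 ≤ Lstar) {y : Fin d}
    (h : Lstar + 4 / η < lossBetween ℓ s n y) :
    weight η (score Lstar ℓ n) y ≤ Real.exp (-2) * weight η (score Lstar ℓ s) y := by
  unfold weight score
  rw [← Real.exp_add, Real.exp_le_exp]
  have h1 : max (lossBetween ℓ 0 s y) Lstar + 4 / η ≤ max (lossBetween ℓ 0 n y) Lstar := by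
    refine le_max_of_le_left ?_
    rw [← lossBetween_add ℓ hsn y]
    have := lossBetween_nonneg ℓ 0 s y
    rcases max_cases (lossBetween ℓ 0 s y) Lstar with h' | h' <;> linarith
  have h2 := mul_le_mul_of_nonneg_left h1 hη.le
  rw [mul_add, mul_div_cancel₀ _ hη.ne'] at h2
  linarith

lemma totalWeight_le_decay_mul [NeZero d] (hη : 0 < η) (hL : 0 ≤ Lstar) {s n t : ℕ} (hsn : s ≤ n)
    (hnt : n ≤ t) {x : Fin d} (h : Lstar + 4 / η < lossBetween ℓ s n x) :
    totalWeight η Lstar ℓ t ≤ decay η Lstar ℓ s x * totalWeight η Lstar ℓ s := by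
  classical
  set D := noLaterThan (Lstar + 4 / η) ℓ s x with hD
  have h1 : decay η Lstar ℓ s x * totalWeight η Lstar ℓ s =
      Real.exp (-2) * ∑ y ∈ D, weight η (score Lstar ℓ s) y +
        ∑ y ∈ Dᶜ, weight η (score Lstar ℓ s) y := by
    have h2 := (totalWeight_pos η Lstar ℓ s).ne'
    have h3 : totalWeight η Lstar ℓ s = _ := (Finset.sum_add_sum_compl D _).symm
    have h4 : ∑ y ∈ Dᶜ, weight η (score Lstar ℓ s) y =
      totalWeight η Lstar ℓ s - ∑ y ∈ D, weight η (score Lstar ℓ s) y := by rw [h3]; ring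
    rw [h4, decay, ← hD]
    field_simp
    ring
  rw [h1, totalWeight, ← Finset.sum_add_sum_compl D, Finset.mul_sum]
  refine add_le_add (Finset.sum_le_sum fun y hy => ?_)
    (Finset.sum_le_sum fun y _ => weight_score_anti hη.le _ _ (hsn.trans hnt) y)
  have hy' : Lstar + 4 / η < lossBetween ℓ s n y := by
    have hy' : ∀ n, Lstar + 4 / η < lossBetween ℓ s n x → Lstar + 4 / η < lossBetween ℓ s n y := by
      simpa [hD, noLaterThan] using hy
    exact hy' n h
  exact (weight_score_anti hη.le _ _ hnt y).trans (weight_le_of_lt_lossBetween hη hsn hL hy')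

lemma mem_noLaterThan_or (Θ : ℝ) (ℓ : Losses T d) (s : ℕ) (x y : Fin d) :
    y ∈ noLaterThan Θ ℓ s x ∨ x ∈ noLaterThan Θ ℓ s y := by
  simp only [noLaterThan, Finset.mem_filter, Finset.mem_univ, true_and]
  by_contra! h
  obtain ⟨⟨m, h1, h2⟩, n, h3, h4⟩ := h
  rcases le_total m n with hmn | hmn
  · exact absurd (h1.trans_le (lossBetween_mono_right ℓ s hmn x)) h4.not_gt
  · exact absurd (h3.trans_le (lossBetween_mono_right ℓ s hmn y)) h2.not_gt

/-- The expected decay for an expert drawn from the exponential mechanism. For two independent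
draws, the second one is in `noLaterThan` of the first with probability at least one half, by
symmetry. -/
lemma sum_weight_mul_decay_le [NeZero d] (s : ℕ) :
    ∑ x, weight η (score Lstar ℓ s) x * decay η Lstar ℓ s x ≤
      (1 + Real.exp (-2)) / 2 * totalWeight η Lstar ℓ s := by
  classical
  set w := weight η (score Lstar ℓ s) with hw
  set W := totalWeight η Lstar ℓ s with hW
  set D := noLaterThan (Lstar + 4 / η) ℓ s with hD
  have hW0 : 0 < W := totalWeight_pos ..
  have hw0 : ∀ x, 0 < w x := fun x => weight_pos ..
  have hsum : ∑ x, w x = W := rfl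
  have hhalf : W ^ 2 ≤ 2 * ∑ x, w x * ∑ y ∈ D x, w y := by
    have h1 : ∀ x, ∑ y ∈ D x, w y = ∑ y, if y ∈ D x then w y else 0 := fun x => by
      rw [← Finset.sum_filter]; simp
    have h2 : ∑ x, w x * ∑ y ∈ D x, w y = ∑ x, ∑ y, if y ∈ D x then w x * w y else 0 := by
      refine Finset.sum_congr rfl fun x _ => ?_
      rw [h1, Finset.mul_sum]
      simp
    have h3 : ∑ x, w x * ∑ y ∈ D x, w y = ∑ x, ∑ y, if x ∈ D y then w x * w y else 0 := by
      rw [h2, Finset.sum_comm]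
      simp only [mul_comm]
    rw [two_mul]
    nth_rw 1 [h2]
    rw [h3, ← Finset.sum_add_distrib, sq, ← hsum, Finset.sum_mul_sum]
    refine Finset.sum_le_sum fun x _ => ?_
    rw [← Finset.sum_add_distrib]
    refine Finset.sum_le_sum fun y _ => ?_
    have := mul_pos (hw0 x) (hw0 y)
    have := mem_noLaterThan_or (Lstar + 4 / η) ℓ s x y
    split_ifs <;> first | linarith | simp_all
  have hexp : ∑ x, w x * decay η Lstar ℓ s x =
      W - (1 - Real.exp (-2)) * ((∑ x, w x * ∑ y ∈ D x, w y) / W) := by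
    rw [Finset.sum_div, Finset.mul_sum, ← hsum, ← Finset.sum_sub_distrib]
    refine Finset.sum_congr rfl fun x _ => ?_
    unfold decay
    rw [hsum]
    ring
  have h4 : W / 2 ≤ (∑ x, w x * ∑ y ∈ D x, w y) / W := by
    rw [le_div_iff₀ hW0]
    nlinarith
  have h5 : Real.exp (-2) ≤ 1 := Real.exp_le_one_iff.2 (by norm_num)
  rw [hexp]
  nlinarith

lemma one_add_exp_neg_two_div_two_le : (1 + Real.exp (-2)) / 2 ≤ Real.exp (-(1 / 2)) := by
  have h2 : Real.exp (-2) = Real.exp (-(1 / 2)) ^ 4 := by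
    rw [← Real.exp_nat_mul]; norm_num
  have hlow : (3 / 5 : ℝ) ≤ Real.exp (-(1 / 2)) := by
    have h := Real.exp_one_lt_d9
    have h3 : Real.exp (-(1 / 2)) ^ 2 * Real.exp 1 = 1 := by
      rw [← Real.exp_nat_mul, ← Real.exp_add]; norm_num
    by_contra! h4
    nlinarith [Real.exp_pos (-(1 / 2)), Real.exp_pos 1]
  have hup : Real.exp (-(1 / 2)) ≤ 5 / 8 := by
    have h := Real.exp_one_gt_d9
    have h3 : Real.exp (-(1 / 2)) ^ 2 * Real.exp 1 = 1 := by
      rw [← Real.exp_nat_mul, ← Real.exp_add]; norm_num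
    by_contra! h4
    nlinarith [Real.exp_pos (-(1 / 2)), Real.exp_pos 1]
  rw [h2]
  set u := Real.exp (-(1 / 2))
  have hu2 : u ^ 2 ≤ 25 / 64 := by nlinarith
  nlinarith [sq_nonneg u, sq_nonneg (u ^ 2)]

end

section

variable {K L z η Lstar : ℝ} {ℓ : Losses T d} {x₀ : Fin d} {ω : Fin T → Seed d}

/-- Every replacement of an expert lowers the total weight by the factor `decay`, but the total
weight cannot fall below that of the best expert. -/
lemma exp_neg_two_div_le_prod_decay [NeZero d] (hη : 0 < η) (hL : 0 ≤ Lstar)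
    (hz : ∀ r t, |(ω t).2.1 - (ω r).1| < z) (hLz : L = Lstar + 4 / η + z)
    (hx : ∃ x : Fin d, ∑ t, (ℓ t x : ℝ) ≤ Lstar) :
    Real.exp (-2) / d ≤ ∏ t ∈ switchRounds (run K L ℓ (x₀, ω)),
      decay η Lstar ℓ t (run K L ℓ (x₀, ω) t.succ).expert := by
  set σ := run K L ℓ (x₀, ω) with hσ
  set W := totalWeight η Lstar ℓ with hW
  set Q : ℕ → ℝ := fun n => ∏ t ∈ switchRoundsBefore σ n, decay η Lstar ℓ t (σ t.succ).expert
    with hQ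
  have hdec : ∀ s x, 0 < decay η Lstar ℓ s x := fun s x =>
    (Real.exp_pos _).trans_le (exp_neg_two_le_decay s x)
  have hWanti : ∀ {m n : ℕ}, m ≤ n → W n ≤ W m := fun h =>
    Finset.sum_le_sum fun x _ => weight_score_anti hη.le Lstar ℓ h x
  have hWpos : ∀ n, 0 < W n := fun n => totalWeight_pos ..
  have key : (stateAfter K L ℓ x₀ ω T).start ≤ T ∧ (1 ≤ Q T ∨
      decay η Lstar ℓ (stateAfter K L ℓ x₀ ω T).start (stateAfter K L ℓ x₀ ω T).expert *
        W (stateAfter K L ℓ x₀ ω T).start ≤ Q T * W 0) ∧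
      ((stateAfter K L ℓ x₀ ω T).phase = .triggered →
        ∃ m ≤ T, (stateAfter K L ℓ x₀ ω T).start ≤ m ∧ Lstar + 4 / η <
          lossBetween ℓ (stateAfter K L ℓ x₀ ω T).start m (stateAfter K L ℓ x₀ ω T).expert) := by
    refine stateAfter_induction (P := fun n s => s.start ≤ n ∧ (1 ≤ Q n ∨
      decay η Lstar ℓ s.start s.expert * W s.start ≤ Q n * W 0) ∧
      (s.phase = .triggered → ∃ m ≤ n, s.start ≤ m ∧ Lstar + 4 / η <
        lossBetween ℓ s.start m s.expert)) 0 ?_ ?_ ?_ ?_ ?_ T T.zero_le le_rfl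
    · simp [stateAfter, hQ, switchRoundsBefore_zero]
    · rintro t s - hs ⟨h1, h2, h3⟩ h
      obtain ⟨m, hm, hsm, hm'⟩ := h3 h
      have hWt : W t ≤ Q t * W 0 := by
        rcases h2 with h2 | h2
        · nlinarith [hWanti (Nat.zero_le t), hWpos 0]
        · exact (totalWeight_le_decay_mul hη hL hsm hm hm').trans h2
      rw [hs] at h
      have hexp : (σ t.succ).expert = (ω t).2.2 := by
        rw [hσ, run_succ, expert_succ_of_triggered h]
      have hQs : Q (t + 1) = decay η Lstar ℓ t (ω t).2.2 * Q t := by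
        simp only [hQ]
        rw [switchRoundsBefore_succ_of_triggered (by rw [hσ, run_castSucc]; exact h),
          Finset.prod_insert (notMem_switchRoundsBefore σ t), hexp]
      refine ⟨by simp only; omega, .inr ?_, by simp⟩
      rw [hQs, mul_assoc]
      exact mul_le_mul_of_nonneg_left hWt (hdec _ _).le
    · rintro t r s - hs ⟨h1, h2, -⟩ hq hle
      have hne := hq.phase_ne_triggered
      have hQs : Q (t + 1) = Q t := by
        simp only [hQ]
        rw [switchRoundsBefore_succ_of_ne (by rw [hσ, run_castSucc, ← hs]; exact hne)]
      rw [hQs]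
      have hn := (abs_lt.1 (hz r t)).2
      refine ⟨by simp only; omega, h2, fun _ => ⟨t, by omega, h1, ?_⟩⟩
      simp only
      linarith
    · rintro t r s - hs ⟨h1, h2, -⟩ hq -
      have hne := hq.phase_ne_triggered
      have hQs : Q (t + 1) = Q t := by
        simp only [hQ]
        rw [switchRoundsBefore_succ_of_ne (by rw [hσ, run_castSucc, ← hs]; exact hne)]
      rw [hQs]
      exact ⟨by simp only; omega, h2, by simp⟩
    · rintro t s - hs ⟨h1, h2, -⟩ hst
      have hne : s.phase ≠ .triggered := by simp [hst.1]
      have hQs : Q (t + 1) = Q t := by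
        simp only [hQ]
        rw [switchRoundsBefore_succ_of_ne (by rw [hσ, run_castSucc, ← hs]; exact hne)]
      rw [hQs]
      exact ⟨by omega, h2, fun h => absurd h hne⟩
  have hQT : Q T = ∏ t ∈ switchRounds σ, decay η Lstar ℓ t (σ t.succ).expert := by
    simp only [hQ, switchRoundsBefore_last]
  rw [← hQT]
  have hd : (1 : ℝ) ≤ d := by exact_mod_cast NeZero.one_le
  have he : Real.exp (-2) ≤ 1 := Real.exp_le_one_iff.2 (by norm_num)
  rw [div_le_iff₀ (by linarith)]
  rcases key.2.1 with h | h
  · nlinarith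
  · obtain ⟨x, hx⟩ := hx
    have hw0 : ∀ y, weight η (score Lstar ℓ 0) y = Real.exp (-η * Lstar / 2) := by
      intro y
      rw [weight, score, lossBetween_self, max_eq_right hL]
    have hW0 : W 0 = d * Real.exp (-η * Lstar / 2) := by
      simp [hW, totalWeight, hw0]
    have hws : ∀ s, Real.exp (-η * Lstar / 2) ≤ W s := by
      intro s
      refine le_trans ?_ (Finset.single_le_sum (fun y _ => (weight_pos _ _ y).le)
        (Finset.mem_univ x))
      rw [weight, score, max_eq_right ((lossBetween_le_total ℓ 0 s x).trans hx)]
    rw [hW0] at h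
    have h2 := mul_le_mul (exp_neg_two_le_decay (η := η) (Lstar := Lstar) (ℓ := ℓ)
      (stateAfter K L ℓ x₀ ω T).start (stateAfter K L ℓ x₀ ω T).expert)
      (hws (stateAfter K L ℓ x₀ ω T).start) (Real.exp_pos _).le (hdec _ _).le
    have h3 := h2.trans h
    rw [← mul_assoc] at h3
    exact le_of_mul_le_mul_right h3 (Real.exp_pos _)

end

/-! ### Probability of a large loss -/

/-- A union bound over all pairs of a threshold and a query. Bounding the two noises separately
would lose a constant factor in the deviation `z`, which is why pairs are considered. -/
lemma seedLaw_noise_le [NeZero d] {b z : ℝ} (hb : 0 < b) (p : Fin T → PMF (Fin d)) :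
    seedLaw (b / 2) b p {q | ¬∀ r t, |(q.2 t).2.1 - (q.2 r).1| < z} ≤
      ENNReal.ofReal (4 * T ^ 2 * Real.exp (-z / b)) := by
  have hb2 := half_pos hb
  have := isProbabilityMeasure_laplace hb
  have := isProbabilityMeasure_laplace hb2
  have := isProbabilityMeasure_noiseLaw T hb2 hb
  have hpair : ∀ r t : Fin T, MeasurePreserving
      (fun q : Fin d × (Fin T → Seed d) => ((q.2 r).1, (q.2 t).2.1)) (seedLaw (b / 2) b p)
      ((laplace (b / 2)).prod (laplace b)) := fun r t =>
    ((measurePreserving_eval (fun _ : Fin T => laplace (b / 2)) r).prod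
      (measurePreserving_eval (fun _ : Fin T => laplace b) t)).comp
      (measurePreserving_fst.comp (measurePreserving_snd.comp
        (measurePreserving_splitSeeds hb2 hb p)))
  have hone : ∀ r t : Fin T, seedLaw (b / 2) b p {q | z ≤ |(q.2 t).2.1 - (q.2 r).1|} ≤
      ENNReal.ofReal (4 * Real.exp (-z / b)) := by
    intro r t
    have hsub : {q : Fin d × (Fin T → Seed d) | z ≤ |(q.2 t).2.1 - (q.2 r).1|} ⊆
        (fun q : Fin d × (Fin T → Seed d) => ((q.2 r).1, (q.2 t).2.1)) ⁻¹'
          ({w | z ≤ w.2 - w.1} ∪ {w | z ≤ w.1 - w.2}) := by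
      intro q hq
      change z ≤ |(q.2 t).2.1 - (q.2 r).1| at hq
      rcases le_abs.1 hq with h | h
      · exact .inl h
      · exact .inr (by simpa using h)
    refine (measure_mono hsub).trans ?_
    rw [(hpair r t).measure_preimage (((measurableSet_le (by fun_prop) (by fun_prop)).union
      (measurableSet_le (by fun_prop) (by fun_prop))).nullMeasurableSet)]
    refine (measure_union_le _ _).trans ((add_le_add (laplace_prod_le_sub_le hb z)
      (laplace_prod_le_sub_le' hb z)).trans ?_)
    rw [← ENNReal.ofReal_add (by positivity) (by positivity)]
    refine ENNReal.ofReal_le_ofReal (le_of_eq ?_)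
    ring
  have hsub : {q : Fin d × (Fin T → Seed d) | ¬∀ r t, |(q.2 t).2.1 - (q.2 r).1| < z} ⊆
      ⋃ r : Fin T, ⋃ t : Fin T, {q | z ≤ |(q.2 t).2.1 - (q.2 r).1|} := by
    intro q hq
    change ¬∀ r t, |(q.2 t).2.1 - (q.2 r).1| < z at hq
    push Not at hq
    simpa using hq
  calc _ ≤ ∑ r : Fin T, ∑ t : Fin T, ENNReal.ofReal (4 * Real.exp (-z / b)) :=
        (measure_mono hsub).trans ((measure_iUnion_fintype_le _ _).trans
          (Finset.sum_le_sum fun r _ => (measure_iUnion_fintype_le _ _).trans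
            (Finset.sum_le_sum fun t _ => hone r t)))
    _ = _ := by
        simp only [Finset.sum_const, Finset.card_univ, Fintype.card_fin, nsmul_eq_mul]
        rw [← ENNReal.ofReal_natCast, ← ENNReal.ofReal_mul (by positivity),
          ← ENNReal.ofReal_mul (by positivity)]
        congr 1
        ring

/-- As long as the noise is small, `K` switches are unlikely: each of them lowers the expected
product of the factors `decay` by a factor of `exp (-1 / 2)`, but this product is bounded below. -/
lemma seedLaw_switches_le [NeZero d] {K L z η Lstar b₁ b₂ : ℝ} {ℓ : Losses T d} (hb₁ : 0 < b₁)
    (hb₂ : 0 < b₂) (hη : 0 < η) (hL : 0 ≤ Lstar) (hLz : L = Lstar + 4 / η + z)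
    (hx : ∃ x : Fin d, ∑ t, (ℓ t x : ℝ) ≤ Lstar) :
    seedLaw b₁ b₂ (fun t : Fin T => expMech η (score Lstar ℓ t))
      {q | (∀ r t, |(q.2 t).2.1 - (q.2 r).1| < z) ∧
        K ≤ (stateAfter K L ℓ q.1 q.2 T).switches} ≤
      ENNReal.ofReal (d * Real.exp (2 - K / 2)) := by
  set p : Fin T → PMF (Fin d) := fun t => expMech η (score Lstar ℓ t) with hp
  set g : Fin T → Fin d → ENNReal :=
    fun t x => ENNReal.ofReal (decay η Lstar ℓ t x * Real.exp (1 / 2)) with hg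
  have hdec : ∀ s x, 0 < decay η Lstar ℓ s x := fun s x =>
    (Real.exp_pos _).trans_le (exp_neg_two_le_decay s x)
  have hg1 : ∀ t, ∑ x, p t x * g t x ≤ 1 := by
    intro t
    have hW := totalWeight_pos η Lstar ℓ t
    have h : ∀ x, p t x * g t x = ENNReal.ofReal (weight η (score Lstar ℓ t) x *
        decay η Lstar ℓ t x * (Real.exp (1 / 2) / totalWeight η Lstar ℓ t)) := by
      intro x
      simp only [hp, hg]
      rw [expMech_apply, ← totalWeight,
        ← ENNReal.ofReal_mul (div_nonneg (weight_pos ..).le hW.le)]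
      congr 1
      ring
    rw [Finset.sum_congr rfl fun x _ => h x, ← ENNReal.ofReal_sum_of_nonneg fun x _ =>
      mul_nonneg (mul_nonneg (weight_pos ..).le (hdec _ _).le) (by positivity),
      ← Finset.sum_mul, ENNReal.ofReal_le_one]
    calc _ ≤ (Real.exp (-(1 / 2)) * totalWeight η Lstar ℓ t) *
          (Real.exp (1 / 2) / totalWeight η Lstar ℓ t) := by
          refine mul_le_mul_of_nonneg_right ((sum_weight_mul_decay_le (t : ℕ)).trans ?_)
            (by positivity)
          exact mul_le_mul_of_nonneg_right one_add_exp_neg_two_div_two_le hW.le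
      _ = Real.exp (-(1 / 2)) * Real.exp (1 / 2) := by field_simp
      _ = 1 := by rw [← Real.exp_add]; simp
  set θ : ℝ := (d * Real.exp (2 - K / 2))⁻¹ with hθ
  have hd : (0 : ℝ) < d := by exact_mod_cast Nat.pos_of_ne_zero (NeZero.ne d)
  have hθ0 : 0 < θ := by positivity
  have hmarkov := (mul_meas_ge_le_lintegral₀ (μ := transcriptLaw K L ℓ b₁ b₂ p)
    (f := fun σ => ∏ t ∈ switchRounds σ, g t (σ t.succ).expert)
    (Measurable.of_discrete).aemeasurable (ENNReal.ofReal θ)).trans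
    (lintegral_prod_switchRounds_le_one K L ℓ hb₁ hb₂ p g hg1)
  unfold transcriptLaw at hmarkov
  rw [Measure.map_apply (measurable_run K L ℓ) (Set.to_countable _).measurableSet] at hmarkov
  rw [← inv_inv (_ * Real.exp _), ← hθ, ENNReal.ofReal_inv_of_pos hθ0, ENNReal.le_inv_iff_mul_le,
    mul_comm]
  refine le_trans ?_ hmarkov
  gcongr
  rintro ⟨x₀, ω⟩ ⟨hz, hK⟩
  simp only at hz hK
  change ENNReal.ofReal θ ≤ ∏ t ∈ switchRounds (run K L ℓ (x₀, ω)), g t _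
  rw [hg, ← ENNReal.ofReal_prod_of_nonneg fun t _ => mul_nonneg (hdec _ _).le (Real.exp_pos _).le,
    Finset.prod_mul_distrib, Finset.prod_const, ← Real.exp_nat_mul]
  refine ENNReal.ofReal_le_ofReal ?_
  have hcard := card_switchRoundsBefore K L ℓ x₀ ω le_rfl
  rw [switchRoundsBefore_last] at hcard
  calc θ = Real.exp (-2) / d * Real.exp (K / 2) := by
        rw [hθ, mul_inv, ← Real.exp_neg, div_mul_eq_mul_div, ← Real.exp_add]
        ring_nf
    _ ≤ _ := by
        refine mul_le_mul (exp_neg_two_div_le_prod_decay hη hL hz hLz hx) ?_ (Real.exp_pos _).le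
          (Finset.prod_nonneg fun t _ => (hdec _ _).le)
        rw [Real.exp_le_exp, hcard]
        linarith

lemma log_two_le_log_one_div {β : ℝ} (hβ : 0 < β) (hβ2 : β < 1 / 2) :
    Real.log 2 ≤ Real.log (1 / β) := by
  refine Real.log_le_log (by norm_num) ?_
  rw [le_div_iff₀ hβ]
  linarith

lemma le_switchBound (d : ℕ) (β : ℝ) :
    6 * Real.log d + 24 * Real.log (1 / β) ≤ switchBound d β := by
  have := Nat.le_ceil (Real.log d)
  unfold switchBound
  linarith

lemma sixteen_le_switchBound {d : ℕ} {β : ℝ} (hβ : 0 < β) (hβ2 : β < 1 / 2) :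
    16 ≤ switchBound d β := by
  have h1 := le_switchBound d β
  have h2 := log_two_le_log_one_div hβ hβ2
  have h3 := Real.log_two_gt_d9
  have h4 := Real.log_natCast_nonneg d
  linarith

lemma switchBound_add_one_le {d : ℕ} {β : ℝ} (hβ : 0 < β) (hβ2 : β < 1 / 2) :
    switchBound d β + 1 ≤ 35 * (Real.log d + Real.log (1 / β)) := by
  have h1 := Nat.ceil_lt_add_one (Real.log_natCast_nonneg d)
  have h2 := log_two_le_log_one_div hβ hβ2
  have h3 := Real.log_two_gt_d9
  have h4 := Real.log_natCast_nonneg d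
  unfold switchBound
  linarith

lemma switchBound_le {d : ℕ} {β : ℝ} (hβ : 0 < β) (hβ2 : β < 1 / 2) :
    switchBound d β ≤ 33 * (Real.log d + Real.log (1 / β)) := by
  have h1 := Nat.ceil_lt_add_one (Real.log_natCast_nonneg d)
  have h2 := log_two_le_log_one_div hβ hβ2
  have h3 := Real.log_two_gt_d9
  have h4 := Real.log_natCast_nonneg d
  unfold switchBound
  linarith

lemma isFiniteMeasure_sparseVectorExperts [NeZero d] {ε : ℝ} (hε : 0 < ε) (K Lstar η L : ℝ)
    (ℓ : Losses T d) : IsFiniteMeasure (sparseVectorExperts K Lstar η L ε ℓ) := by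
  have := isProbabilityMeasure_laplace (b := 2 / (ε / 2)) (by positivity)
  have := isProbabilityMeasure_laplace (b := 4 / (ε / 2)) (by positivity)
  unfold sparseVectorExperts randomness
  infer_instance

/-- With probability at least `1 - 3 β`, fewer than `K` switches occur and each expert suffers a
loss of at most `L + 8 B / ε + 2` while it is played. -/
lemma one_sub_le_measure_totalLoss_le [NeZero T] [NeZero d] {Lstar ε β η : ℝ} (hL : 0 ≤ Lstar)
    (hε : 0 < ε) (hη : 0 < η) (hβ : 0 < β) (hβ2 : β < 1 / 2) (ℓ : Losses T d)
    (hx : ∃ x : Fin d, ∑ t, (ℓ t x : ℝ) ≤ Lstar) :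
    1 - 3 * β ≤ (sparseVectorExperts (switchBound d β) Lstar η (threshold T Lstar η ε β) ε ℓ).real
      {x | totalLoss ℓ x ≤ (switchBound d β + 1) *
        (Lstar + 4 / η + 16 * Real.log (2 * (T : ℝ) ^ 2 / β) / ε + 2)} := by
  set K := switchBound d β with hK
  set L := threshold T Lstar η ε β with hLdef
  set B := Real.log (2 * (T : ℝ) ^ 2 / β) with hB
  set z := 8 * B / ε with hz
  set p : Fin T → PMF (Fin d) := fun t => expMech η (score Lstar ℓ t) with hp
  have hT : (1 : ℝ) ≤ T := by exact_mod_cast NeZero.one_le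
  have hd : (1 : ℝ) ≤ d := by exact_mod_cast NeZero.one_le
  have hB0 : 0 ≤ B := by
    refine Real.log_nonneg ?_
    rw [le_div_iff₀ hβ]
    nlinarith
  have hLz : L = Lstar + 4 / η + z := rfl
  have hz0 : 0 ≤ z := by positivity
  have hM : 0 ≤ L + z := by rw [hLz]; positivity
  have hb₂ : 0 < 4 / (ε / 2) := by positivity
  have hb₁ : 2 / (ε / 2) = 4 / (ε / 2) / 2 := by ring
  set μ := seedLaw (4 / (ε / 2) / 2) (4 / (ε / 2)) p with hμ
  have hμr : sparseVectorExperts K Lstar η L ε ℓ = μ.map (plays K L ℓ) := by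
    rw [hμ, ← hb₁]
    rfl
  have := isProbabilityMeasure_laplace hb₂
  have := isProbabilityMeasure_laplace (half_pos hb₂)
  have hμp : IsProbabilityMeasure μ := by rw [hμ]; unfold seedLaw; infer_instance
  set X := (K + 1) * (Lstar + 4 / η + 16 * B / ε + 2) with hX
  have hXe : X = (K + 1) * (L + z + 2) := by rw [hX, hLz, hz]; ring
  have hms : MeasurableSet {x : Fin T → Fin d | totalLoss ℓ x ≤ X} :=
    (Set.to_countable _).measurableSet
  have hbad : (μ.map (plays K L ℓ)) {x | totalLoss ℓ x ≤ X}ᶜ ≤ ENNReal.ofReal (3 * β) := by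
    rw [Measure.map_apply (measurable_plays K L ℓ) hms.compl]
    have hsub : plays K L ℓ ⁻¹' {x | totalLoss ℓ x ≤ X}ᶜ ⊆
        {q | ¬∀ r t, |(q.2 t).2.1 - (q.2 r).1| < z} ∪
        {q | (∀ r t, |(q.2 t).2.1 - (q.2 r).1| < z) ∧
          K ≤ (stateAfter K L ℓ q.1 q.2 T).switches} := by
      rintro ⟨x₀, ω⟩ hq
      by_cases hn : ∀ r t, |(ω t).2.1 - (ω r).1| < z
      · refine .inr ⟨hn, ?_⟩
        by_contra hlt
        refine hq ?_
        change totalLoss ℓ (plays K L ℓ (x₀, ω)) ≤ X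
        rw [hXe]
        exact totalLoss_plays_le hn hM (not_le.1 hlt)
      · exact .inl hn
    refine (measure_mono hsub).trans ((measure_union_le _ _).trans ((add_le_add
      (seedLaw_noise_le hb₂ p) (seedLaw_switches_le (half_pos hb₂) hb₂ hη hL hLz hx)).trans ?_))
    rw [← ENNReal.ofReal_add (by positivity) (by positivity)]
    refine ENNReal.ofReal_le_ofReal ?_
    have h1 : 4 * (T : ℝ) ^ 2 * Real.exp (-z / (4 / (ε / 2))) = 2 * β := by
      have h2 : -z / (4 / (ε / 2)) = -B := by rw [hz]; field_simp; ring
      rw [h2, Real.exp_neg, hB, Real.exp_log (by positivity)]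
      field_simp
      norm_num
    have h2 : d * Real.exp (2 - K / 2) ≤ β := by
      have h3 := le_switchBound d β
      have h4 := log_two_le_log_one_div hβ hβ2
      have h5 := Real.log_two_gt_d9
      have h6 := Real.log_natCast_nonneg d
      have h7 : Real.log (1 / β) = -Real.log β := by rw [one_div, Real.log_inv]
      calc d * Real.exp (2 - K / 2) = Real.exp (Real.log d + (2 - K / 2)) := by
            rw [Real.exp_add, Real.exp_log (by linarith)]
        _ ≤ Real.exp (Real.log β) := by
            rw [Real.exp_le_exp]
            linarith
        _ = β := Real.exp_log hβ
    linarith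
  rw [hμr]
  have h2 : (μ.map (plays K L ℓ)).real {x | totalLoss ℓ x ≤ X} +
      (μ.map (plays K L ℓ)).real {x | totalLoss ℓ x ≤ X}ᶜ = 1 := by
    rw [measureReal_add_measureReal_compl hms,
      map_measureReal_apply (measurable_plays K L ℓ) MeasurableSet.univ]
    simp
  have h3 : (μ.map (plays K L ℓ)).real {x | totalLoss ℓ x ≤ X}ᶜ ≤ 3 * β :=
    ENNReal.toReal_le_of_le_ofReal (by positivity) hbad
  linarith

/-! ### Simplifying the loss bound -/

lemma rpow_three_halves {x : ℝ} (hx : 0 ≤ x) : x ^ (3 / 2 : ℝ) = x * √x := by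
  rw [show (3 / 2 : ℝ) = 1 + 1 / 2 by norm_num, Real.rpow_add_of_nonneg hx zero_le_one
    (by norm_num), Real.rpow_one, Real.sqrt_eq_rpow]

/-- The loss bound with all terms but the one that depends on `η` simplified. In this and the
following lemmas, `D = log d`, `b = log (1 / β)`, `τ = log (T / β)` and `l = log (1 / δ)`. -/
lemma loss_bound_le {c K Lstar ε η B D b τ : ℝ} (hL : 0 ≤ Lstar) (hε : 0 < ε)
    (hη : 0 < η) (hD : 0 ≤ D) (hb : 0 < b) (hB0 : 0 ≤ B) (hB : B ≤ 2 * τ)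
    (hK : K + 1 ≤ 35 * (D + b)) (hετ : ε ≤ c * τ) :
    (K + 1) * (Lstar + 4 / η + 16 * B / ε + 2) ≤
      35 * (D + b) * (Lstar + 4 / η) + (1120 + 70 * c) * (τ * (D + b) / ε) := by
  have h1 : 16 * B / ε + 2 ≤ (32 + 2 * c) * τ / ε := by
    rw [div_add' _ _ _ hε.ne', div_le_div_iff_of_pos_right hε]
    linarith
  calc (K + 1) * (Lstar + 4 / η + 16 * B / ε + 2)
      ≤ (35 * (D + b)) * (Lstar + 4 / η + (32 + 2 * c) * τ / ε) :=
        mul_le_mul hK (by linarith) (by positivity) (by linarith)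
    _ = _ := by ring

lemma loss_bound_le_of_le {c K Lstar ε η B D b τ R : ℝ} (hc : 0 < c) (hL : 0 ≤ Lstar) (hε : 0 < ε)
    (hη : 0 < η) (hD : 0 ≤ D) (hb : 0 < b) (hB0 : 0 ≤ B) (hB : B ≤ 2 * τ)
    (hK : K + 1 ≤ 35 * (D + b)) (hετ : ε ≤ c * τ) (hR0 : 0 ≤ R)
    (hR : 35 * (D + b) * (4 / η) ≤ 18480 * (1 + c) ^ 2 * ((R + τ * (D + b)) / ε)) :
    (K + 1) * (Lstar + 4 / η + 16 * B / ε + 2) ≤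
      20000 * (1 + c) ^ 2 * (Lstar * (D + b) + (R + τ * (D + b)) / ε) := by
  have h := loss_bound_le hL hε hη hD hb hB0 hB hK hετ
  have h1 : 0 ≤ τ * (D + b) / ε := by
    have : 0 ≤ τ := by linarith
    positivity
  have h2 : τ * (D + b) / ε ≤ (R + τ * (D + b)) / ε := by
    gcongr
    linarith
  have h3 : 0 ≤ Lstar * (D + b) := by positivity
  have h4 : 1120 + 70 * c ≤ 1120 * (1 + c) ^ 2 := by nlinarith
  have h5 := mul_le_mul h4 h2 h1 (by positivity)
  have h6 : 35 * (Lstar * (D + b)) ≤ 20000 * (1 + c) ^ 2 * (Lstar * (D + b)) := by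
    refine mul_le_mul_of_nonneg_right ?_ h3
    nlinarith
  have h7 : 0 ≤ (1 + c) ^ 2 * ((R + τ * (D + b)) / ε) :=
    mul_nonneg (by positivity) (h1.trans h2)
  linarith

lemma pure_term_le {c K ε η D b τ : ℝ} (hc : 0 < c) (hε : 0 < ε) (hD : 0 ≤ D) (hb : 0 < b)
    (hbτ : b ≤ τ) (hK : K ≤ 33 * (D + b)) (hη : η = ε / (2 * K)) :
    35 * (D + b) * (4 / η) ≤ 18480 * (1 + c) ^ 2 * ((D ^ 2 + τ * (D + b)) / ε) := by
  have h1 : 4 / η = 8 * K / ε := by rw [hη, div_div_eq_mul_div]; ring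
  rw [h1, mul_div_assoc', mul_div_assoc', div_le_div_iff_of_pos_right hε]
  have h2 : (D + b) ^ 2 ≤ D ^ 2 + 2 * (τ * (D + b)) := by nlinarith
  have h3 : 35 * (D + b) * (8 * K) ≤ 9240 * (D + b) ^ 2 := by nlinarith
  have h4 : 0 ≤ τ * (D + b) := by nlinarith
  have h5 : (1 : ℝ) ≤ (1 + c) ^ 2 := by nlinarith
  have h6 : 1 * (D ^ 2 + τ * (D + b)) ≤ (1 + c) ^ 2 * (D ^ 2 + τ * (D + b)) :=
    mul_le_mul_of_nonneg_right h5 (by positivity)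
  nlinarith [sq_nonneg D]

lemma approx_term_le {K ε η D b l : ℝ} (hε : 0 < ε) (hD : 0 ≤ D) (hb : 0 < b)
    (hl : 0 < l) (hK : K ≤ 33 * (D + b)) (hη : η = ε / (4 * √(2 * K * l))) :
    35 * (D + b) * (4 / η) ≤ 5040 * ((D + b) * √(D + b) * √l) / ε := by
  have h1 : 4 / η = 16 * √(2 * K * l) / ε := by rw [hη, div_div_eq_mul_div]; ring
  have h2 : √(2 * K * l) ≤ 9 * (√(D + b) * √l) := by
    rw [← Real.sqrt_mul (by linarith)]
    refine Real.sqrt_le_iff.2 ⟨by positivity, ?_⟩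
    rw [mul_pow, Real.sq_sqrt (by positivity)]
    nlinarith [mul_le_mul_of_nonneg_right hK hl.le, mul_nonneg (add_nonneg hD hb.le) hl.le]
  rw [h1, mul_div_assoc', div_le_div_iff_of_pos_right hε]
  have h3 := mul_le_mul_of_nonneg_left h2 (by linarith : 0 ≤ 35 * (D + b) * 16)
  linarith

/-- If `log (1 / δ)` is at most of the order of `log (T / β)`, or `log (1 / β)` at most of the order
of `log d`, then the power of `log (d / β)` can be replaced by a power of `log d`. -/
lemma mul_sqrt_le {c D b τ l : ℝ} (hc : 0 < c) (hD : 0 ≤ D) (hb : 0 < b) (hbτ : b ≤ τ)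
    (h : l ≤ c * τ ∨ b ≤ c * D) :
    (D + b) * √(D + b) * √l ≤ 3 * (1 + c) ^ 2 * (D * √D * √l + τ * (D + b)) := by
  have hτ : 0 < τ := hb.trans_le hbτ
  have h0 : 0 ≤ D * √D * √l := by positivity
  have h0' : 0 ≤ τ * (D + b) := by positivity
  have h1c : (1 : ℝ) ≤ (1 + c) ^ 2 := by nlinarith
  have hmul : ∀ a : ℝ, 1 ≤ a → D + b ≤ a * D → (D + b) * √(D + b) ≤ a * a * (D * √D) := by
    intro a ha hle
    have h1 : √(D + b) ≤ a * √D := by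
      refine (Real.sqrt_le_sqrt hle).trans ?_
      rw [Real.sqrt_mul (by linarith)]
      gcongr
      exact Real.sqrt_le_iff.2 ⟨by linarith, by nlinarith⟩
    calc (D + b) * √(D + b) ≤ (a * D) * (a * √D) :=
          mul_le_mul hle h1 (Real.sqrt_nonneg _) (by positivity)
      _ = _ := by ring
  rcases h with h | h
  · rcases le_total b D with hbD | hbD
    · have h1 : √(D + b) ≤ 3 / 2 * √D := by
        refine Real.sqrt_le_iff.2 ⟨by positivity, ?_⟩
        rw [mul_pow, Real.sq_sqrt hD]
        linarith
      have h2 : (D + b) * √(D + b) * √l ≤ 3 * (D * √D * √l) := by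
        calc (D + b) * √(D + b) * √l ≤ (2 * D) * (3 / 2 * √D) * √l := by
              gcongr
              linarith
          _ = _ := by ring
      nlinarith
    · have h1 : √(D + b) * √l ≤ (1 + c) * τ := by
        rw [← Real.sqrt_mul (by linarith)]
        refine Real.sqrt_le_iff.2 ⟨by positivity, ?_⟩
        have h3 : (D + b) * l ≤ (2 * τ) * (c * τ) := by
          calc (D + b) * l ≤ (D + b) * (c * τ) := by gcongr
            _ ≤ _ := by
              gcongr
              linarith
        nlinarith [sq_nonneg ((1 - c) * τ), sq_nonneg τ, sq_nonneg (c * τ)]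
      have h2 : (D + b) * √(D + b) * √l ≤ (1 + c) * (τ * (D + b)) := by
        calc (D + b) * √(D + b) * √l = (D + b) * (√(D + b) * √l) := by ring
          _ ≤ (D + b) * ((1 + c) * τ) := by gcongr
          _ = _ := by ring
      nlinarith [mul_nonneg hc.le h0', mul_nonneg (sq_nonneg c) h0', mul_nonneg hc.le h0,
        mul_nonneg (sq_nonneg c) h0]
  · have h1 := hmul (1 + c) (by linarith) (by linarith)
    have h2 := mul_le_mul_of_nonneg_right h1 (Real.sqrt_nonneg l)
    nlinarith [mul_nonneg hc.le h0', mul_nonneg (sq_nonneg c) h0', mul_nonneg hc.le h0,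
      mul_nonneg (sq_nonneg c) h0]

end PrivateExperts

end

open PrivateExperts in
theorem mainTheorem1 (c : ℝ) (hc : 0 < c) :
    ∃ C : ℝ, 0 < C ∧
      ∀ (T d : ℕ) [NeZero T] [NeZero d] (Lstar ε β : ℝ),
        0 ≤ Lstar → 0 < ε → 0 < β → β < 1 / 2 →
        -- pure privacy, `η = ε / (2K)`
        (∀ η : ℝ, η = ε / (2 * switchBound d β) →
          IsDP (fun ℓ : Losses T d =>
            sparseVectorExperts (switchBound d β) Lstar η (threshold T Lstar η ε β) ε ℓ) ε 0 ∧
          (ε ≤ c * Real.log (T / β) →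
            ∀ ℓ : Losses T d, (∃ x : Fin d, ∑ t, (ℓ t x : ℝ) ≤ Lstar) →
              1 - C * β ≤
                (sparseVectorExperts (switchBound d β) Lstar η
                  (threshold T Lstar η ε β) ε ℓ).real
                {x | totalLoss ℓ x ≤ C * (Lstar * Real.log (d / β) +
                  (Real.log d ^ 2 + Real.log (T / β) * Real.log (d / β)) / ε)})) ∧
        -- approximate privacy, `η = ε / (4 √(2 K log (1/δ)))`
        (∀ δ η : ℝ, 0 < δ → δ < 1 →
          ε ≤ √(Real.log T * Real.log (1 / δ)) →
          η = ε / (4 * √(2 * switchBound d β * Real.log (1 / δ))) →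
          (ε ≤ Real.log (1 / δ) →
            IsDP (fun ℓ : Losses T d =>
              sparseVectorExperts (switchBound d β) Lstar η (threshold T Lstar η ε β) ε ℓ) ε δ) ∧
          (ε ≤ c * Real.log (T / β) →
            ∀ ℓ : Losses T d, (∃ x : Fin d, ∑ t, (ℓ t x : ℝ) ≤ Lstar) →
              1 - C * β ≤
                (sparseVectorExperts (switchBound d β) Lstar η
                  (threshold T Lstar η ε β) ε ℓ).real
                {x | totalLoss ℓ x ≤ C * (Lstar * Real.log (d / β) +
                  (Real.log (d / β) ^ (3 / 2 : ℝ) * √(Real.log (1 / δ)) +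
                    Real.log (T / β) * Real.log (d / β)) / ε)} ∧
              (Real.log (1 / δ) ≤ c * Real.log (T / β) ∨ Real.log (1 / β) ≤ c * Real.log d →
                1 - C * β ≤
                  (sparseVectorExperts (switchBound d β) Lstar η
                    (threshold T Lstar η ε β) ε ℓ).real
                  {x | totalLoss ℓ x ≤ C * (Lstar * Real.log (d / β) +
                    (Real.log d ^ (3 / 2 : ℝ) * √(Real.log (1 / δ)) +
                      Real.log (T / β) * Real.log (d / β)) / ε)}))) := by
  refine ⟨20000 * (1 + c) ^ 2, by positivity, fun T d _ _ Lstar ε β hL hε hβ hβ2 => ?_⟩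
  have hT : (1 : ℝ) ≤ T := by exact_mod_cast NeZero.one_le
  have hd : (1 : ℝ) ≤ d := by exact_mod_cast NeZero.one_le
  set K := switchBound d β with hK
  set D := Real.log d with hDdef
  set b := Real.log (1 / β) with hbdef
  set τ := Real.log (T / β) with hτdef
  set B := Real.log (2 * (T : ℝ) ^ 2 / β) with hBdef
  have hD : 0 ≤ D := Real.log_natCast_nonneg d
  have hb : 0 < b := (Real.log_pos one_lt_two).trans_le (log_two_le_log_one_div hβ hβ2)
  have hDb : Real.log (d / β) = D + b := by
    rw [hDdef, hbdef, ← Real.log_mul (by positivity) (by positivity), mul_one_div]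
  have hbτ : b ≤ τ := Real.log_le_log (by positivity) (by gcongr)
  have hB0 : 0 ≤ B := by
    refine Real.log_nonneg ?_
    rw [le_div_iff₀ hβ]
    nlinarith
  have hB : B ≤ 2 * τ := by
    have h : 2 * τ = Real.log ((T / β) ^ 2) := by rw [Real.log_pow]; norm_num; rfl
    rw [h]
    refine Real.log_le_log (by positivity) ?_
    rw [div_pow, div_le_div_iff₀ hβ (by positivity)]
    have : 0 ≤ (T : ℝ) ^ 2 * β * (1 - 2 * β) :=
      mul_nonneg (by positivity) (by linarith)
    nlinarith
  have hK16 : 16 ≤ K := sixteen_le_switchBound hβ hβ2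
  have hK35 : K + 1 ≤ 35 * (D + b) := switchBound_add_one_le hβ hβ2
  have hK33 : K ≤ 33 * (D + b) := switchBound_le hβ hβ2
  have hC : (3 : ℝ) * β ≤ 20000 * (1 + c) ^ 2 * β := by
    refine mul_le_mul_of_nonneg_right ?_ hβ.le
    nlinarith
  have hprob : ∀ (η : ℝ) (hη : 0 < η) (ℓ : Losses T d)
      (_ : ∃ x : Fin d, ∑ t, (ℓ t x : ℝ) ≤ Lstar) (R : ℝ)
      (_ : (K + 1) * (Lstar + 4 / η + 16 * B / ε + 2) ≤ R),
      1 - 20000 * (1 + c) ^ 2 * β ≤ (sparseVectorExperts K Lstar η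
        (threshold T Lstar η ε β) ε ℓ).real {x | totalLoss ℓ x ≤ R} := by
    intro η hη ℓ hx R hR
    have h := one_sub_le_measure_totalLoss_le hL hε hη hβ hβ2 ℓ hx
    have hfin : IsFiniteMeasure (sparseVectorExperts K Lstar η
        (threshold T Lstar η ε β) ε ℓ) := isFiniteMeasure_sparseVectorExperts hε _ _ _ _ _
    have hmono : (sparseVectorExperts K Lstar η (threshold T Lstar η ε β) ε ℓ).real
        {x | totalLoss ℓ x ≤ (K + 1) * (Lstar + 4 / η + 16 * B / ε + 2)} ≤
        (sparseVectorExperts K Lstar η (threshold T Lstar η ε β) ε ℓ).real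
          {x | totalLoss ℓ x ≤ R} := measureReal_mono fun x hx => le_trans hx hR
    linarith
  rw [hDb]
  refine ⟨fun η hη => ?_, fun δ η hδ hδ1 _ hη => ?_⟩
  · have hη0 : 0 < η := by rw [hη]; positivity
    refine ⟨isDP_pure (by linarith) hε hη, fun hετ ℓ hx => hprob η hη0 ℓ hx _ ?_⟩
    exact loss_bound_le_of_le hc hL hε hη0 hD hb hB0 hB hK35 hετ (by positivity)
      (pure_term_le hc hε hD hb hbτ hK33 hη)
  · have hl : 0 < Real.log (1 / δ) := Real.log_pos (by rw [lt_div_iff₀ hδ]; linarith)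
    have hη0 : 0 < η := by rw [hη]; positivity
    have hterm := approx_term_le hε hD hb hl hK33 hη
    have h1c : (1 : ℝ) ≤ (1 + c) ^ 2 := by nlinarith
    have hτ0 : 0 ≤ τ * (D + b) := mul_nonneg (hb.le.trans hbτ) (by linarith)
    refine ⟨fun hεδ => isDP_approx (by linarith) hε hδ hεδ hη,
      fun hετ ℓ hx => ⟨hprob η hη0 ℓ hx _ ?_, fun h => hprob η hη0 ℓ hx _ ?_⟩⟩
    · rw [rpow_three_halves (by linarith)]
      have hR0 : 0 ≤ (D + b) * √(D + b) * √(Real.log (1 / δ)) := by positivity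
      refine loss_bound_le_of_le hc hL hε hη0 hD hb hB0 hB hK35 hετ hR0 (hterm.trans ?_)
      rw [mul_div_assoc']
      refine div_le_div_of_nonneg_right ?_ hε.le
      nlinarith
    · rw [rpow_three_halves hD]
      have hR0 : 0 ≤ D * √D * √(Real.log (1 / δ)) := by positivity
      refine loss_bound_le_of_le hc hL hε hη0 hD hb hB0 hB hK35 hετ hR0 (hterm.trans ?_)
      rw [mul_div_assoc']
      refine div_le_div_of_nonneg_right ?_ hε.le
      have := mul_sqrt_le hc hD hb hbτ h
      nlinarith [mul_nonneg (sq_nonneg (1 + c)) (add_nonneg hR0 hτ0)]
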